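/- \textbf{Proposition (Realizability of $\mathcal D_\mu$).} Let $V$ be a finite set, $K\ge 1$, let $\mathcal D^{(1)},\dots,\mathcal D^{(K)}$ be DAGs on the node set $V$, and let $I\subseteq V$ be a set of nodes such that every $v\in I$ has the same parents in all $\mathcal D^{(j)}$, and $I=V$ if $K=1$. The \emph{mixture DAG} $\mathcal D_\mu$ with these components and invariant set $I$ has as nodes the copies $v^{(j)}$ ($v\in V$, $1\le j\le K$) together with one more node $y$, and as edges $u^{(j)}\to v^{(j)}$ whenever $u\to v$ in $\mathcal D^{(j)}$, and $y\to v^{(j)}$ for all $j$ and all $v\in V\setminus I$. For $A\subseteq V$ write $[A]=\{v^{(j)}: v\in A,\ 1\le j\le K\}$. For every such mixture DAG there are weights $p_J(1),\dots,p_J(K)>0$ with $\sum_j p_J(j)=1$ and probability distributions $p^{(1)},\dots,p^{(K)}$ on $\mathbb R^V$ with positive densities that factorize according to the component DAGs, $p^{(j)}(x_V)=\prod_{v\in V}p^{(j)}(x_v\mid x_{\mathrm{pa}_{\mathcal D^{(j)}}(v)})$, such that (i) the set of invariant nodes $V_{\mathrm{INV}}=\{v\in V:\ p^{(j)}(x_v\mid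 x_{\mathrm{pa}_{\mathcal D^{(j)}}(v)})=p^{(k)}(x_v\mid x_{\mathrm{pa}_{\mathcal D^{(k)}}(v)})\text{ for all }j,k\}$ (equality for almost every $x_V$) equals $I$, that is, $\mathcal D_\mu$ is the mixture DAG of this mixture; and (ii) the mixture distribution $p_\mu=\sum_{j}p_J(j)\,p^{(j)}$ is faithful with respect to $\mathcal D_\mu$: for all pairwise disjoint $A,B,C\subseteq V$, if $X_A$ and $X_B$ are conditionally independent given $X_C$ under $p_\mu$, then $[A]$ and $[B]$ are d-separated given $[C]$ in $\mathcal D_\mu$. -/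

import Mathlib

open MeasureTheory ProbabilityTheory
open scoped ENNReal NNReal

/-! ### Directed acyclic graphs and d-separation -/

/-- A directed graph is acyclic if it has no directed cycle (in particular no loop). -/
def Digraph.IsAcyclicDigraph {W : Type*} (G : Digraph W) : Prop :=
  ∀ w, ¬ Relation.TransGen G.Adj w w

/-- `G.parents v` is the set of parents of `v`: the `u` with `u → v`. -/
def Digraph.parents {W : Type*} (G : Digraph W) (v : W) : Set W :=
  {u | G.Adj u v}

/-- A path: a list of distinct vertices in which consecutive vertices are joined by an edge, in
either direction. (In an acyclic digraph the edge between consecutive vertices is unique.) -/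
def Digraph.IsUndirectedPath {W : Type*} (G : Digraph W) (l : List W) : Prop :=
  l.Nodup ∧ l.IsChain (fun u v => G.Adj u v ∨ G.Adj v u)

/-- A path is active (not blocked) given `C` if every inner vertex `v` of it that is a collider
(`u → v ← w` on the path) is in `C` or has a descendant in `C`, and every inner vertex that is not
a collider is outside `C`. -/
def Digraph.IsActive {W : Type*} (G : Digraph W) (C : Set W) (l : List W) : Prop :=
  ∀ u v w, [u, v, w] <:+: l →
    ((G.Adj u v ∧ G.Adj w v) → ∃ d ∈ C, Relation.ReflTransGen G.Adj v d) ∧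
    (¬ (G.Adj u v ∧ G.Adj w v) → v ∉ C)

/-- `A` and `B` are d-separated given `C`: no path between a vertex of `A` and a vertex of `B` is
active given `C`. -/
def Digraph.DSeparated {W : Type*} (G : Digraph W) (A B C : Set W) : Prop :=
  ¬ ∃ a ∈ A, ∃ b ∈ B, ∃ l : List W,
    G.IsUndirectedPath l ∧ l.head? = some a ∧ l.getLast? = some b ∧ G.IsActive C l

/-! ### Mixture DAGs -/

/-- The combinatorial data of a mixture DAG on `V` with `K` components: the component DAGs
`D⁽¹⁾, …, D⁽ᴷ⁾` and the set `inv` of nodes declared invariant, i.e. whose conditional distribution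
given their parents is the same in all components. An invariant node has the same parents in all
components, and if there is only one component, then every node is invariant. -/
structure MixtureDAG (V : Type*) (K : ℕ) where
  component : Fin K → Digraph V
  acyclic : ∀ j, (component j).IsAcyclicDigraph
  inv : Set V
  parents_eq : ∀ v ∈ inv, ∀ j k, (component j).parents v = (component k).parents v
  inv_of_single : K = 1 → inv = Set.univ

/-- The mixture DAG as a directed graph. The vertex `some (v, j)` is the copy `v⁽ʲ⁾` of `v` in the
`j`-th component and `none` is the extra node `y`. The edges are those of the components, and
`y → v⁽ʲ⁾` for every `j` and every `v` that is not invariant. -/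
def MixtureDAG.graph {V : Type*} {K : ℕ} (G : MixtureDAG V K) : Digraph (Option (V × Fin K)) where
  Adj
    | some (u, i), some (v, j) => i = j ∧ (G.component j).Adj u v
    | none, some (v, _) => v ∉ G.inv
    | _, none => False

/-- `[A]`: all `K` copies of the nodes in `A`. -/
def MixtureDAG.copies {V : Type*} (K : ℕ) (A : Set V) : Set (Option (V × Fin K)) :=
  {w | ∃ v ∈ A, ∃ j : Fin K, w = some (v, j)}

/-! ### Mixtures of DAG models -/

/-- The measure on `ℝ^V` with Lebesgue density `x ↦ ∏ v, q v x`. -/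
noncomputable def productDensityMeasure {V : Type*} [Fintype V] (q : V → (V → ℝ) → ℝ) :
    Measure (V → ℝ) :=
  volume.withDensity (fun x => ENNReal.ofReal (∏ v, q v x))

/-- A mixture of distributions on `ℝ^V` that factorize according to the digraphs `D j`.
`cond j v x` is the conditional density `p⁽ʲ⁾(x_v | x_pa(v))`, where `pa(v)` are the parents of `v`
in `D j`: it is a positive measurable function of `x_v` and `x_pa(v)` only, and a probability
density in `x_v`. The `j`-th component `p⁽ʲ⁾` is the probability distribution with density
`∏ v, p⁽ʲ⁾(x_v | x_pa(v))`; it has the mixture weight `p_J(j) > 0`. -/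
structure MixtureModel {V : Type*} [Fintype V] [DecidableEq V] {K : ℕ}
    (D : Fin K → Digraph V) where
  weight : Fin K → ℝ≥0
  weight_pos : ∀ j, 0 < weight j
  weight_sum : ∑ j, weight j = 1
  cond : Fin K → V → (V → ℝ) → ℝ
  cond_pos : ∀ j v x, 0 < cond j v x
  cond_measurable : ∀ j v, Measurable (cond j v)
  cond_dependsOn : ∀ j v, DependsOn (cond j v) (insert v ((D j).parents v))
  cond_lintegral : ∀ j v x, ∫⁻ t : ℝ, ENNReal.ofReal (cond j v (Function.update x v t)) = 1
  isProbabilityMeasure_component : ∀ j, IsProbabilityMeasure (productDensityMeasure (cond j))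

namespace MixtureModel

variable {V : Type*} [Fintype V] [DecidableEq V] {K : ℕ} {D : Fin K → Digraph V}

/-- The `j`-th component distribution `p⁽ʲ⁾` of a mixture. -/
noncomputable def component (M : MixtureModel D) (j : Fin K) : Measure (V → ℝ) :=
  productDensityMeasure (M.cond j)

/-- The mixture distribution `p_μ = ∑ j, p_J(j) p⁽ʲ⁾` of `X_V`. -/
noncomputable def law (M : MixtureModel D) : Measure (V → ℝ) :=
  ∑ j, M.weight j • M.component j

instance (M : MixtureModel D) : IsProbabilityMeasure M.law where
  measure_univ := by
    have h : ∀ j, M.component j Set.univ = 1 := fun j =>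
      (M.isProbabilityMeasure_component j).measure_univ
    have hs : ∑ j, (M.weight j : ℝ≥0∞) = 1 := by
      exact_mod_cast congrArg (fun r : ℝ≥0 => (r : ℝ≥0∞)) M.weight_sum
    simp [law, Measure.finsetSum_apply, h, hs]

/-- The invariant nodes `V_INV`: those whose conditional density is the same in all components.
(As all densities are positive, a conditional density is determined by the component up to a
Lebesgue null set.) -/
def invariantNodes (M : MixtureModel D) : Set V :=
  {v | ∀ j k, M.cond j v =ᵐ[volume] M.cond k v}

end MixtureModel

/-- `X_A` and `X_B` are conditionally independent given `X_C` under the law `P` of `X_V`. -/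
def CondIndepCoords {V : Type*} [Fintype V] (P : Measure (V → ℝ)) [IsFiniteMeasure P]
    (A B C : Set V) : Prop :=
  CondIndepFun (MeasurableSpace.comap (fun (x : V → ℝ) (c : C) => x c) inferInstance)
    (Measurable.comap_le (measurable_pi_lambda _ fun c => measurable_pi_apply c.1))
    (fun (x : V → ℝ) (a : A) => x a) (fun (x : V → ℝ) (b : B) => x b) P

/-- `P` is faithful with respect to the mixture DAG `G`: whenever `X_A ⊥⊥ X_B | X_C` under `P` for
disjoint `A`, `B`, `C`, the copies `[A]` and `[B]` are d-separated given `[C]` in `G`. -/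
def MixtureDAG.IsFaithful {V : Type*} [Fintype V] {K : ℕ} (G : MixtureDAG V K)
    (P : Measure (V → ℝ)) [IsFiniteMeasure P] : Prop :=
  ∀ A B C : Set V, Disjoint A B → Disjoint A C → Disjoint B C → CondIndepCoords P A B C →
    G.graph.DSeparated (MixtureDAG.copies K A) (MixtureDAG.copies K B) (MixtureDAG.copies K C)

/-! ### Generic points of analytic functions -/

/-! The mixture is built so that everything is decided by the signs of the coordinates. Each
conditional density is `exp (-|x_v|)` times a Bernoulli weight for the sign of `x_v`, whose
parameter depends on the signs of the parents. Since `exp (-|t|)` has mass 1 on each half-line, the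
signs form a mixture of binary Bayesian networks. On the event that `X_C` is positive, the signs are
independent of `X_C`, so conditional independence of `X_A` and `X_B` given `X_C` makes the signs of
`a ∈ A` and `b ∈ B` uncorrelated given that all signs in `C` are positive
(`HasSignDensity.cov_eq_zero_of_condIndep`).

This covariance, cleared of denominators, is a polynomial in the parameters and the weights. There
are finitely many triples `(C, a, b)`, so one admissible choice makes all the polynomials that are
not identically zero nonzero at once (`exists_forall_ne_zero_of_analytic`). It remains to find, for
each d-connected triple, some real parameters with nonzero covariance, possibly outside the
admissible range.

d-connection is used in the form of a Bayes ball, a walk that may revisit vertices and so behaves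
well when a vertex is deleted. For a single DAG, `Digraph.exists_condCov_ne_zero` removes one sink
at a time. A sink outside `C` can be summed out. A sink in `C` reweights the law by an arbitrary
function of its parents, and `uncorrelated_of_forall_reweight` shows that such reweightings create
the dependence that a collider should create.

In the mixture DAG the ball either stays in one component, which then gets all the weight, or passes
through `y`. In the latter case completeness for a component together with `y` shows that the
conditional probabilities of both `x a` and `x b` can be made to differ between two components, and
mixing these two correlates `x a` with `x b` (`MixtureDAG.exists_mixCov_ne_zero`). -/

theorem AnalyticOnNhd.dense_ne_zero {E : Type*} [NormedAddCommGroup E] [NormedSpace ℝ E]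
    {F : E → ℝ} (hF : AnalyticOnNhd ℝ F Set.univ) (h : ∃ x, F x ≠ 0) :
    Dense {x | F x ≠ 0} := by
  by_contra hd
  obtain ⟨x, hx⟩ := h
  rw [dense_iff_inter_open] at hd
  push Not at hd
  obtain ⟨U, hU, ⟨y, hy⟩, hUF⟩ := hd
  refine hx ?_
  have h0 : F =ᶠ[nhds y] 0 := by
    filter_upwards [hU.mem_nhds hy] with z hz
    by_contra hne
    exact Set.notMem_empty z (hUF ▸ ⟨hz, hne⟩)
  exact hF.eqOn_zero_of_preconnected_of_eventuallyEq_zero isPreconnected_univ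
    (Set.mem_univ y) h0 (Set.mem_univ x)

/-- Finitely many dense open sets have a dense intersection. Conditions that are only known to be
achievable one at a time can thus be met together, and inside any prescribed open set. -/
theorem exists_forall_ne_zero_of_analytic {E ι : Type*} [NormedAddCommGroup E] [NormedSpace ℝ E]
    [Finite ι] {F : ι → E → ℝ} (hF : ∀ i, AnalyticOnNhd ℝ (F i) Set.univ)
    (h : ∀ i, ∃ x, F i x ≠ 0) {U : Set E} (hU : IsOpen U) (hne : U.Nonempty) :
    ∃ x ∈ U, ∀ i, F i x ≠ 0 := by
  cases nonempty_fintype ι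
  have hprod : ∀ s : Finset ι, Dense {x | ∏ i ∈ s, F i x ≠ 0} := by
    classical
    intro s
    induction s using Finset.induction_on with
    | empty => simp
    | insert i s hi ih =>
      have ho : IsOpen {x | F i x ≠ 0} :=
        isOpen_ne_fun (continuousOn_univ.1 (hF i).continuousOn) continuous_const
      convert (hF i).dense_ne_zero (h i) |>.inter_of_isOpen_left ih ho using 1
      ext x
      simp [Finset.prod_insert hi]
  obtain ⟨x, hxU, hx⟩ := dense_iff_inter_open.1 (hprod Finset.univ) U hU hne
  exact ⟨x, hxU, fun i => Finset.prod_ne_zero_iff.1 hx i (Finset.mem_univ i)⟩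

/-! ### Reachability by the Bayes ball -/

/-- The moves of the Bayes ball for the edge relation `R` and conditioning set `C`. In the state
`(v, true)` the ball has come to `v` from a child, in the state `(v, false)` from a parent. -/
inductive BallStep {W : Type*} (R : W → W → Prop) (C : Set W) : W × Bool → W × Bool → Prop
  | up {u v : W} : v ∉ C → R u v → BallStep R C (v, true) (u, true)
  | down {v w : W} (d : Bool) : v ∉ C → R v w → BallStep R C (v, d) (w, false)
  | bounce {u v : W} : v ∈ C → R u v → BallStep R C (v, false) (u, true)

/-- The Bayes ball can get from one state to another. -/
def BallReach {W : Type*} (R : W → W → Prop) (C : Set W) : W × Bool → W × Bool → Prop :=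
  Relation.ReflTransGen (BallStep R C)

section Ball

variable {W : Type*} {R : W → W → Prop} {C : Set W}

theorem BallReach.eq_of_mem {w : W} (hw : w ∈ C) {st : W × Bool}
    (h : BallReach R C (w, true) st) : st = (w, true) := by
  rcases Relation.ReflTransGen.cases_head h with h | ⟨st', h, -⟩
  · exact h.symm
  · cases h <;> contradiction

/-- The ball rolls down to the first vertex in `C`, bounces there and climbs back through vertices
outside `C`. This is how it passes a collider that is opened by a descendant. -/
theorem ballReach_parent_of_descendant {v d : W} (hvd : Relation.ReflTransGen R v d)
    (hd : d ∈ C) {w : W} (hw : R w v) : BallReach R C (v, false) (w, true) := by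
  induction hvd using Relation.ReflTransGen.head_induction_on generalizing w with
  | refl => exact .single (.bounce hd hw)
  | @head v v' hv _ ih =>
    by_cases hC : v ∈ C
    · exact .single (.bounce hC hw)
    · exact ((Relation.ReflTransGen.single (.down false hC hv)).trans (ih hv)).tail (.up hC hw)

/-- The ball follows the path, with a detour at each collider. The hypothesis `hu` keeps the
direction of arrival in agreement with the last edge. -/
theorem ballReach_of_isActive {G : Digraph W} (hG : ∀ u v, G.Adj u v → ¬ G.Adj v u)
    {st : W × Bool} (l : List W) (u v : W)
    (hu : BallReach G.Adj C st (v, true) ∧ G.Adj v u ∨ BallReach G.Adj C st (v, false) ∧ G.Adj u v)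
    (hch : (u :: v :: l).IsChain (fun u v => G.Adj u v ∨ G.Adj v u))
    (hact : G.IsActive C (u :: v :: l)) {b : W} (hb : (v :: l).getLast? = some b) :
    ∃ d, BallReach G.Adj C st (b, d) := by
  induction l generalizing u v with
  | nil =>
    obtain rfl : v = b := by simpa using hb
    rcases hu with h | h
    exacts [⟨_, h.1⟩, ⟨_, h.1⟩]
  | cons w l ih =>
    have htr := hact u v w ⟨[], l, rfl⟩
    have hch' := (List.isChain_cons_cons.1 hch).2
    have hact' : G.IsActive C (v :: w :: l) := fun x y z h => hact x y z (h.trans ⟨[u], [], by simp⟩)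
    refine ih v w ?_ hch' hact' (by simpa using hb)
    rcases hu with ⟨hr, hadj⟩ | ⟨hr, hadj⟩
    · have hv : v ∉ C := htr.2 fun h => hG _ _ h.1 hadj
      rcases (List.isChain_cons_cons.1 hch').1 with h | h
      · exact .inr ⟨hr.tail (.down _ hv h), h⟩
      · exact .inl ⟨hr.tail (.up hv h), h⟩
    · rcases (List.isChain_cons_cons.1 hch').1 with h | h
      · have hv : v ∉ C := htr.2 fun h' => hG _ _ h'.2 h
        exact .inr ⟨hr.tail (.down _ hv h), h⟩
      · obtain ⟨d, hd, hvd⟩ := htr.1 ⟨hadj, h⟩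
        exact .inl ⟨hr.trans (ballReach_parent_of_descendant hvd hd h), h⟩

theorem ballReach_of_not_dSeparated {G : Digraph W} (hG : ∀ u v, G.Adj u v → ¬ G.Adj v u)
    {A B : Set W} (hA : Disjoint A C) (h : ¬ G.DSeparated A B C) :
    ∃ a ∈ A, ∃ b ∈ B, ∃ d, BallReach G.Adj C (a, true) (b, d) := by
  simp only [Digraph.DSeparated, not_not] at h
  obtain ⟨a, ha, b, hb, l, ⟨-, hch⟩, hhead, hlast, hact⟩ := h
  refine ⟨a, ha, b, hb, ?_⟩
  have haC := Set.disjoint_left.1 hA ha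
  match l with
  | [] => simp at hhead
  | [c] =>
    obtain rfl : c = a := by simpa using hhead
    obtain rfl : c = b := by simpa using hlast
    exact ⟨true, .refl⟩
  | c :: v :: l =>
    obtain rfl : c = a := by simpa using hhead
    refine ballReach_of_isActive hG l c v ?_ hch hact (by simpa using hlast)
    rcases (List.isChain_cons_cons.1 hch).1 with h | h
    · exact .inr ⟨.single (.down _ haC h), h⟩
    · exact .inl ⟨.single (.up haC h), h⟩

/-- The edge relation restricted to a set of nodes. -/
def restrictRel (R : W → W → Prop) (S : Set W) (u v : W) : Prop := R u v ∧ u ∈ S ∧ v ∈ S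

variable {S : Set W} {s : W}

theorem restrictRel_diff {u v : W} (h : restrictRel R S u v) (hu : u ≠ s) (hv : v ≠ s) :
    restrictRel R (S \ {s}) u v :=
  ⟨h.1, ⟨h.2.1, hu⟩, h.2.2, hv⟩

theorem BallStep.diff_singleton {st st' : W × Bool} (h : BallStep (restrictRel R S) C st st')
    (h1 : st.1 ≠ s) (h2 : st'.1 ≠ s) : BallStep (restrictRel R (S \ {s})) C st st' := by
  cases h with
  | up hv h => exact .up hv (restrictRel_diff h h2 h1)
  | down d hv h => exact .down d hv (restrictRel_diff h h1 h2)
  | bounce hv h => exact .bounce hv (restrictRel_diff h h2 h1)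

/-- The ball enters a sink from a parent outside `C`. -/
theorem BallStep.of_sink (hs : ∀ w ∈ S, ¬ R s w) {x y : W × Bool}
    (h : BallStep (restrictRel R S) C x y) (hy : y.1 = s) :
    y = (s, false) ∧ x.1 ∈ S ∧ R x.1 s ∧ x.1 ∉ C := by
  subst hy
  cases h with
  | up _ h => exact absurd h.1 (hs _ h.2.2)
  | down d hv h => exact ⟨rfl, h.2.1, h.1, hv⟩
  | bounce _ h => exact absurd h.1 (hs _ h.2.2)

/-- Outside `C`, a sink is a dead end for the ball. -/
theorem BallReach.diff_sink (hs : ∀ w ∈ S, ¬ R s w) (hsC : s ∉ C) {st st' : W × Bool}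
    (h : BallReach (restrictRel R S) C st st') (h1 : st.1 ≠ s) :
    st' = (s, false) ∨ (st'.1 ≠ s ∧ BallReach (restrictRel R (S \ {s})) C st st') := by
  induction h with
  | refl => exact .inr ⟨h1, .refl⟩
  | @tail x y _ hstep ih =>
    rcases ih with rfl | ⟨hx, hr⟩
    · cases hstep with
      | down d _ h => exact absurd h.1 (hs _ h.2.2)
      | bounce h _ => exact absurd h hsC
    · by_cases hy : y.1 = s
      · exact .inl (hstep.of_sink hs hy).1
      · exact .inr ⟨hy, hr.tail (hstep.diff_singleton hx hy)⟩

/-- A ball that comes to a sink outside `C` comes from a parent of it. -/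
theorem BallReach.exists_parent_of_sink (hs : ∀ w ∈ S, ¬ R s w) (hsC : s ∉ C) {st : W × Bool}
    {d : Bool} (h : BallReach (restrictRel R S) C st (s, d)) (h1 : st.1 ≠ s) :
    ∃ w ∈ S, R w s ∧ w ∉ C ∧ ∃ d', BallReach (restrictRel R (S \ {s})) C st (w, d') := by
  rcases Relation.ReflTransGen.cases_tail h with h | ⟨⟨w, d'⟩, h, hstep⟩
  · exact absurd (congrArg Prod.fst h).symm h1
  · obtain ⟨-, hwS, hws, hwC⟩ := hstep.of_sink hs rfl
    refine ⟨w, hwS, hws, hwC, d', ?_⟩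
    rcases BallReach.diff_sink hs hsC h h1 with h | h
    · obtain rfl : w = s := congrArg Prod.fst h
      exact absurd hws (hs _ hwS)
    · exact h.2

/-- A ball that passes through a sink bounces from a parent to a parent of it. -/
theorem BallReach.diff_sink_of_mem (hs : ∀ w ∈ S, ¬ R s w) {st st' : W × Bool}
    (h : BallReach (restrictRel R S) C st st') (h1 : st.1 ≠ s) :
    (st'.1 ≠ s ∧ BallReach (restrictRel R (S \ {s})) C st st') ∨
    ∃ u ∈ S, R u s ∧ u ∉ C ∧ (∃ d, BallReach (restrictRel R (S \ {s})) C st (u, d)) ∧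
      (st' = (s, false) ∨ st'.1 ≠ s ∧ ∃ w ∈ S, R w s ∧
        BallReach (restrictRel R (S \ {s})) C (w, true) st') := by
  induction h with
  | refl => exact .inl ⟨h1, .refl⟩
  | @tail x y _ hstep ih =>
    rcases ih with ⟨hx, hr⟩ | ⟨u, huS, hus, huC, hu, hx⟩
    · by_cases hy : y.1 = s
      · obtain ⟨hy, hxS, hxs, hxC⟩ := hstep.of_sink hs hy
        exact .inr ⟨x.1, hxS, hxs, hxC, ⟨x.2, hr⟩, .inl hy⟩
      · exact .inl ⟨hy, hr.tail (hstep.diff_singleton hx hy)⟩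
    · refine .inr ⟨u, huS, hus, huC, hu, ?_⟩
      rcases hx with rfl | ⟨hx, w, hwS, hws, hw⟩
      · cases hstep with
        | down d _ h => exact absurd h.1 (hs _ h.2.2)
        | @bounce w _ _ h =>
          have hws : w ≠ s := fun e => hs s h.2.2 (e ▸ h.1)
          exact .inr ⟨hws, w, h.2.1, h.1, .refl⟩
      · by_cases hy : y.1 = s
        · exact .inl (hstep.of_sink hs hy).1
        · exact .inr ⟨hy, w, hwS, hws, hw.tail (hstep.diff_singleton hx hy)⟩

end Ball

/-! ### Binary Bayesian networks -/

/-- The weight of `b` under the Bernoulli distribution with parameter `t`. -/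
noncomputable def bernoulliWeight (t : ℝ) (b : Bool) : ℝ := if b then t else 1 - t

/-- The coordinate `v` of a binary configuration as a real number. -/
noncomputable def coordInd {W : Type*} (v : W) (x : W → Bool) : ℝ := if x v then 1 else 0

open Classical in
/-- The indicator function of the configurations that are `true` on `C`. -/
noncomputable def trueOn {W : Type*} (C : Set W) (x : W → Bool) : ℝ :=
  if ∀ c ∈ C, x c = true then 1 else 0

open Classical in
/-- The configuration of the parents of `v`, extended by `false`. -/
noncomputable def Digraph.parentConfig {W : Type*} (D : Digraph W) (v : W) (x : W → Bool) :
    W → Bool :=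
  fun u => decide (D.Adj u v) && x u

/-- The conditional probability of `x v` given the parents of `v`, in the binary network with
parameters `θ`. -/
noncomputable def Digraph.kernel {W : Type*} (D : Digraph W) (θ : W → (W → Bool) → ℝ) (v : W)
    (x : W → Bool) : ℝ :=
  bernoulliWeight (θ v (D.parentConfig v x)) (x v)

/-- The sum of `g` over the configurations that are `true` on `C`, weighted with the conditional
probabilities of the nodes in `S`. -/
noncomputable def Digraph.condSum {W : Type*} [Fintype W] [DecidableEq W] (D : Digraph W)
    (θ : W → (W → Bool) → ℝ) (S : Finset W) (C : Set W) (g : (W → Bool) → ℝ) : ℝ :=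
  ∑ x, trueOn C x * (∏ v ∈ S, D.kernel θ v x) * g x

/-- The (unnormalized) covariance of `x a` and `x b` given that `x` is `true` on `C`. -/
noncomputable def Digraph.condCov {W : Type*} [Fintype W] [DecidableEq W] (D : Digraph W)
    (θ : W → (W → Bool) → ℝ) (S : Finset W) (C : Set W) (a b : W) : ℝ :=
  D.condSum θ S C (fun x => coordInd a x * coordInd b x) * D.condSum θ S C (fun _ => 1) -
    D.condSum θ S C (coordInd a) * D.condSum θ S C (coordInd b)

theorem bernoulliWeight_pos {t : ℝ} (h0 : 0 < t) (h1 : t < 1) (b : Bool) :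
    0 < bernoulliWeight t b := by
  cases b <;> simp [bernoulliWeight, h0, h1]

theorem coordInd_nonneg {W : Type*} (v : W) (x : W → Bool) : 0 ≤ coordInd v x := by
  unfold coordInd; split_ifs <;> norm_num

theorem trueOn_nonneg {W : Type*} (C : Set W) (x : W → Bool) : 0 ≤ trueOn C x := by
  unfold trueOn; split_ifs <;> norm_num

theorem trueOn_update {W : Type*} [DecidableEq W] {C : Set W} {s : W} (hs : s ∉ C) (x : W → Bool)
    (b : Bool) : trueOn C (Function.update x s b) = trueOn C x := by
  have : (∀ c ∈ C, Function.update x s b c = true) ↔ ∀ c ∈ C, x c = true :=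
    forall₂_congr fun c hc => by
      rw [Function.update_of_ne]; rintro rfl; exact hs hc
  classical
  by_cases h : ∀ c ∈ C, x c = true
  · rw [trueOn, trueOn, if_pos h, if_pos (this.2 h)]
  · rw [trueOn, trueOn, if_neg h, if_neg (mt this.1 h)]

theorem coordInd_update {W : Type*} [DecidableEq W] {v s : W} (hv : v ≠ s) (x : W → Bool) (b : Bool) :
    coordInd v (Function.update x s b) = coordInd v x := by
  rw [coordInd, coordInd, Function.update_of_ne hv]

theorem sum_eq_half_sum_update {W : Type*} [Fintype W] [DecidableEq W] (s : W)
    (h : (W → Bool) → ℝ) :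
    ∑ x, h x = (1 / 2) * ∑ x, (h (Function.update x s true) + h (Function.update x s false)) := by
  have hinv : Function.Involutive fun x : W → Bool => Function.update x s (!x s) := fun x => by simp
  have h1 : ∑ x, h (Function.update x s (!x s)) = ∑ x, h x := Equiv.sum_comp hinv.toPerm h
  have h2 : ∀ x, h (Function.update x s true) + h (Function.update x s false)
      = h x + h (Function.update x s (!x s)) := by
    intro x
    have hx := Function.update_eq_self s x
    cases hs : x s <;> rw [hs] at hx <;> simp only [Bool.not_true, Bool.not_false, hx]
    ring
  simp only [h2, Finset.sum_add_distrib, h1]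
  ring

/-- `Z, A, B, E` are the mass and the moments of two variables and of their product. When two laws
with uncorrelated variables are added, the covariance of the sum is the product of the differences
of the means, up to normalization. -/
theorem polarized_det_eq_zero {Z A B E Z' A' B' E' : ℝ} (h : E * Z = A * B) (h' : E' * Z' = A' * B')
    (h'' : (E + E') * (Z + Z') = (A + A') * (B + B')) :
    (A * Z' - A' * Z) * (B * Z' - B' * Z) = 0 := by
  linear_combination Z * Z' * (h'' - h - h') - Z' ^ 2 * h - Z ^ 2 * h'

namespace Digraph

variable {W : Type*} (D : Digraph W) {θ : W → (W → Bool) → ℝ}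

theorem parentConfig_of_adj {u v : W} (h : D.Adj u v) (x : W → Bool) :
    D.parentConfig v x u = x u := by
  simp [parentConfig, h]

theorem parentConfig_of_not_adj {u v : W} (h : ¬ D.Adj u v) (x : W → Bool) :
    D.parentConfig v x u = false := by
  simp [parentConfig, h]

theorem parentConfig_congr {v : W} {x x' : W → Bool} (h : ∀ u, D.Adj u v → x u = x' u) :
    D.parentConfig v x = D.parentConfig v x' := by
  funext u
  by_cases hu : D.Adj u v <;> simp [parentConfig, hu, h]

theorem kernel_congr {v : W} {x x' : W → Bool} (hv : x v = x' v)
    (h : ∀ u, D.Adj u v → x u = x' u) : D.kernel θ v x = D.kernel θ v x' := by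
  rw [kernel, kernel, D.parentConfig_congr h, hv]

theorem prod_kernel_pos {S : Finset W} (hθ : ∀ v π, 0 < θ v π ∧ θ v π < 1) (x : W → Bool) :
    0 < ∏ v ∈ S, D.kernel θ v x :=
  Finset.prod_pos fun v _ => bernoulliWeight_pos (hθ v _).1 (hθ v _).2 _

variable [Fintype W] [DecidableEq W] {S : Finset W} {C : Set W} {s : W}

theorem condSum_update_param (hs : s ∉ S) (f : (W → Bool) → ℝ) (g : (W → Bool) → ℝ) :
    D.condSum (Function.update θ s f) S C g = D.condSum θ S C g := by
  refine Finset.sum_congr rfl fun x _ => ?_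
  have : ∀ v ∈ S, D.kernel (Function.update θ s f) v x = D.kernel θ v x := fun v hv => by
    rw [kernel, kernel, Function.update_of_ne]
    rintro rfl; exact hs hv
  rw [Finset.prod_congr rfl this]

/-- On the event `x s = true` the factor of `s` is its parameter. As this parameter is free, a sink
in `C` amounts to an arbitrary reweighting by a function of its parents. -/
theorem condSum_of_mem (hs : s ∈ S) (hsC : s ∈ C) (g : (W → Bool) → ℝ) :
    D.condSum θ S C g = D.condSum θ (S.erase s) C (fun x => θ s (D.parentConfig s x) * g x) := by
  refine Finset.sum_congr rfl fun x _ => ?_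
  rw [← Finset.mul_prod_erase S _ hs]
  by_cases h : ∀ c ∈ C, x c = true
  · simp only [kernel, bernoulliWeight, h s hsC, if_true]
    ring
  · simp [trueOn, h]

/-- No other kernel in `S` involves `x s`, so it can be summed out. The factor `1 / 2` appears
because on the right `x s` still runs over both values while its kernel is gone. -/
theorem condSum_of_sink (hs : s ∈ S) (hsC : s ∉ C) (hsS : ∀ w ∈ S, ¬ D.Adj s w)
    (g : (W → Bool) → ℝ) :
    D.condSum θ S C g = (1 / 2) * D.condSum θ (S.erase s) C (fun x =>
      θ s (D.parentConfig s x) * g (Function.update x s true) +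
        (1 - θ s (D.parentConfig s x)) * g (Function.update x s false)) := by
  rw [condSum, sum_eq_half_sum_update s, condSum]
  congr 1
  refine Finset.sum_congr rfl fun x _ => ?_
  have hk : ∀ b, ∏ v ∈ S.erase s, D.kernel θ v (Function.update x s b)
      = ∏ v ∈ S.erase s, D.kernel θ v x := fun b => by
    refine Finset.prod_congr rfl fun v hv => ?_
    rw [Finset.mem_erase] at hv
    refine D.kernel_congr (Function.update_of_ne hv.1 _ _) fun u hu => Function.update_of_ne ?_ _ _
    rintro rfl
    exact hsS v hv.2 hu
  have hp : ∀ b, D.parentConfig s (Function.update x s b) = D.parentConfig s x := fun b => by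
    refine D.parentConfig_congr fun u hu => Function.update_of_ne ?_ _ _
    rintro rfl
    exact hsS _ hs hu
  simp only [← Finset.mul_prod_erase S _ hs, hk, trueOn_update hsC]
  simp only [kernel, bernoulliWeight, hp, Function.update_self, if_true]
  simp only [Bool.false_eq_true, if_false]
  ring

theorem condSum_of_sink_of_update (hs : s ∈ S) (hsC : s ∉ C) (hsS : ∀ w ∈ S, ¬ D.Adj s w)
    {g : (W → Bool) → ℝ} (hg : ∀ x b, g (Function.update x s b) = g x) :
    D.condSum θ S C g = (1 / 2) * D.condSum θ (S.erase s) C g := by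
  rw [D.condSum_of_sink hs hsC hsS]
  simp only [hg]
  congr 2
  funext x
  ring

theorem condSum_mul_coordInd_of_sink (hs : s ∈ S) (hsC : s ∉ C) (hsS : ∀ w ∈ S, ¬ D.Adj s w)
    {g : (W → Bool) → ℝ} (hg : ∀ x b, g (Function.update x s b) = g x) :
    D.condSum θ S C (fun x => g x * coordInd s x)
      = (1 / 2) * D.condSum θ (S.erase s) C (fun x => g x * θ s (D.parentConfig s x)) := by
  rw [D.condSum_of_sink hs hsC hsS]
  simp only [hg, coordInd, Function.update_self, if_true]
  congr 2
  funext x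
  simp [mul_comm]

theorem condCov_comm (a b : W) : D.condCov θ S C a b = D.condCov θ S C b a := by
  unfold condCov
  simp only [mul_comm (coordInd a _)]
  ring

theorem condSum_pos (hθ : ∀ v π, 0 < θ v π ∧ θ v π < 1) {g : (W → Bool) → ℝ}
    (hg : ∀ x, 0 ≤ g x) {x : W → Bool} (hx : ∀ c ∈ C, x c = true) (hgx : 0 < g x) :
    0 < D.condSum θ S C g :=
  Finset.sum_pos' (fun x _ =>
    mul_nonneg (mul_nonneg (trueOn_nonneg C x) (D.prod_kernel_pos hθ x).le) (hg x))
    ⟨x, Finset.mem_univ x, mul_pos (mul_pos (by simp [trueOn, if_pos hx])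
      (D.prod_kernel_pos hθ x)) hgx⟩

theorem condSum_one_pos (hθ : ∀ v π, 0 < θ v π ∧ θ v π < 1) : 0 < D.condSum θ S C (fun _ => 1) :=
  D.condSum_pos hθ (fun _ => zero_le_one) (x := fun _ => true) (fun _ _ => rfl) one_pos

theorem condSum_sub (g h : (W → Bool) → ℝ) :
    D.condSum θ S C (fun x => g x - h x) = D.condSum θ S C g - D.condSum θ S C h := by
  simp only [condSum, mul_sub, Finset.sum_sub_distrib]

/-- The variance is the product of the masses of `x a = true` and `x a = false`, both positive
because `a ∉ C`. -/
theorem condCov_self_pos (hθ : ∀ v π, 0 < θ v π ∧ θ v π < 1) {a : W} (ha : a ∉ C) :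
    0 < D.condCov θ S C a a := by
  have h1 : ∀ x : W → Bool, coordInd a x * coordInd a x = coordInd a x := fun x => by
    unfold coordInd; split_ifs <;> norm_num
  have hA : 0 < D.condSum θ S C (coordInd a) :=
    D.condSum_pos hθ (coordInd_nonneg a) (x := fun _ => true) (fun _ _ => rfl) (by simp [coordInd])
  have hB : 0 < D.condSum θ S C (fun x => 1 - coordInd a x) := by
    refine D.condSum_pos hθ (fun x => ?_) (x := Function.update (fun _ => true) a false)
      (fun c hc => ?_) (by simp [coordInd])
    · unfold coordInd; split_ifs <;> norm_num
    · rw [Function.update_of_ne]; rintro rfl; exact ha hc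
  rw [condSum_sub] at hB
  unfold condCov
  simp only [h1]
  nlinarith [mul_pos hA hB]

/-! ### Analyticity in the parameters -/

theorem analyticOnNhd_condSum {E : Type*} [NormedAddCommGroup E] [NormedSpace ℝ E]
    {p : E → W → (W → Bool) → ℝ} (hp : ∀ v π, AnalyticOnNhd ℝ (fun e => p e v π) Set.univ)
    (g : (W → Bool) → ℝ) :
    AnalyticOnNhd ℝ (fun e => D.condSum (p e) S C g) Set.univ := by
  refine Finset.analyticOnNhd_fun_sum _ fun x _ => ?_
  refine (analyticOnNhd_const.mul (Finset.analyticOnNhd_fun_prod _ fun v _ => ?_)).mul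
    analyticOnNhd_const
  unfold kernel bernoulliWeight
  split_ifs
  · exact hp _ _
  · exact analyticOnNhd_const.sub (hp _ _)

theorem analyticOnNhd_condCov {E : Type*} [NormedAddCommGroup E] [NormedSpace ℝ E]
    {p : E → W → (W → Bool) → ℝ} (hp : ∀ v π, AnalyticOnNhd ℝ (fun e => p e v π) Set.univ)
    (a b : W) : AnalyticOnNhd ℝ (fun e => D.condCov (p e) S C a b) Set.univ :=
  ((D.analyticOnNhd_condSum hp _).mul (D.analyticOnNhd_condSum hp _)).sub
    ((D.analyticOnNhd_condSum hp _).mul (D.analyticOnNhd_condSum hp _))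

end Digraph

/-- The parameters that are positive and less than `1`. -/
def openParams (W : Type*) : Set (W → (W → Bool) → ℝ) := {θ | ∀ v π, 0 < θ v π ∧ θ v π < 1}

theorem isOpen_openParams (W : Type*) [Finite W] : IsOpen (openParams W) := by
  have : openParams W = Set.univ.pi fun _ => Set.univ.pi fun _ => Set.Ioo 0 1 := by
    ext θ; simp [openParams, Set.mem_pi]
  rw [this]
  exact isOpen_set_pi Set.finite_univ fun _ _ => isOpen_set_pi Set.finite_univ fun _ _ => isOpen_Ioo

theorem half_mem_openParams (W : Type*) : (fun _ _ => 1 / 2) ∈ openParams W :=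
  fun _ _ => by norm_num

theorem analyticOnNhd_param {W : Type*} [Fintype W] [DecidableEq W] (v : W) (π : W → Bool) :
    AnalyticOnNhd ℝ (fun θ : W → (W → Bool) → ℝ => θ v π) Set.univ := by
  exact fun θ _ => ((ContinuousLinearMap.proj (R := ℝ) (φ := fun _ : W → Bool => ℝ) π).comp
    (ContinuousLinearMap.proj (R := ℝ) (φ := fun _ : W => (W → Bool) → ℝ) v)).analyticAt θ

/-- If independence of `A` and `B` persists under every reweighting by a function of `c`, then `A`
or `B` is uncorrelated with the functions of `c`. -/
theorem uncorrelated_of_forall_reweight {X Y : Type*} [Fintype X] [Fintype Y] {m A B : X → ℝ}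
    (hm : ∀ x, 0 ≤ m x) (c : X → Y)
    (h : ∀ f : Y → ℝ, (∑ x, m x * (f (c x) * (A x * B x))) * (∑ x, m x * f (c x))
      = (∑ x, m x * (f (c x) * A x)) * (∑ x, m x * (f (c x) * B x))) (U V : Y → ℝ) :
    (∑ x, m x * (A x * U (c x))) * (∑ x, m x) = (∑ x, m x * A x) * (∑ x, m x * U (c x)) ∨
    (∑ x, m x * (V (c x) * B x)) * (∑ x, m x) = (∑ x, m x * V (c x)) * (∑ x, m x * B x) := by
  classical
  let T (g : X → ℝ) (y : Y) : ℝ := ∑ x, if c x = y then m x * g x else 0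
  have hT : ∀ (g : X → ℝ) (f : Y → ℝ), ∑ x, m x * (f (c x) * g x) = ∑ y, f y * T g y := by
    intro g f
    simp only [T, Finset.mul_sum]
    rw [Finset.sum_comm]
    refine Finset.sum_congr rfl fun x _ => ?_
    simp only [mul_ite, mul_zero, Finset.sum_ite_eq, Finset.mem_univ, if_true]
    ring
  let Z := T fun _ => 1
  have hZ : ∀ f : Y → ℝ, ∑ x, m x * f (c x) = ∑ y, f y * Z y := fun f => by
    rw [← hT]; simp
  have hZ0 : ∀ y, Z y = 0 → ∀ g, T g y = 0 := by
    intro y hy g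
    have hnn : ∀ x ∈ Finset.univ, 0 ≤ if c x = y then m x * 1 else 0 := fun x _ => by
      split_ifs <;> simp [hm]
    have := (Finset.sum_eq_zero_iff_of_nonneg hnn).1 hy
    refine Finset.sum_eq_zero fun x hx => ?_
    have hx := this x hx
    split_ifs with hc
    · rw [if_pos hc, mul_one] at hx; rw [hx, zero_mul]
    · rfl
  simp only [hT, hZ] at h
  have hs : ∀ y g, ∑ y', (if y' = y then (1 : ℝ) else 0) * T g y' = T g y := fun y g => by simp
  have hs2 : ∀ y z g, ∑ y', ((if y' = y then (1 : ℝ) else 0) + if y' = z then 1 else 0) * T g y'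
      = T g y + T g z := fun y z g => by simp [add_mul, Finset.sum_add_distrib]
  -- Reweighting by the indicator of one fibre gives independence inside the fibre. The sum of two
  -- indicators then shows, by polarization, that any two fibres agree in the conditional mean of
  -- `A` or in that of `B`.
  have h1 : ∀ y, T (fun x => A x * B x) y * Z y = T A y * T B y := fun y => by
    simpa only [hs, Z] using h fun y' => if y' = y then 1 else 0
  have h2 : ∀ y z, (T A y * Z z - T A z * Z y) * (T B y * Z z - T B z * Z y) = 0 := fun y z =>
    polarized_det_eq_zero (h1 y) (h1 z) (by
      simpa only [hs2, Z] using h fun y' => (if y' = y then 1 else 0) + if y' = z then 1 else 0)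
  have h3 : ∀ y z, Z y ≠ 0 → Z z ≠ 0 → T A y / Z y = T A z / Z z ∨ T B y / Z y = T B z / Z z := by
    intro y z hy hz
    rw [div_eq_div_iff hy hz, div_eq_div_iff hy hz]
    exact (mul_eq_zero.1 (h2 y z)).imp sub_eq_zero.1 sub_eq_zero.1
  -- Agreement in the mean of `A` and agreement in the mean of `B` are equivalence relations on the
  -- fibres of nonzero mass. If two equivalence relations together cover all pairs, one of them
  -- holds for all pairs.
  have h4 : (∀ y z, Z y ≠ 0 → Z z ≠ 0 → T A y / Z y = T A z / Z z) ∨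
      (∀ y z, Z y ≠ 0 → Z z ≠ 0 → T B y / Z y = T B z / Z z) := by
    by_contra hcon
    push Not at hcon
    obtain ⟨⟨y, z, hy, hz, hA⟩, ⟨y', z', hy', hz', hB⟩⟩ := hcon
    have := h3 y z hy hz
    have := h3 y' z' hy' hz'
    have := h3 y y' hy hy'
    have := h3 y z' hy hz'
    have := h3 z y' hz hy'
    have := h3 z z' hz hz'
    grind
  have h5 : ∀ g : X → ℝ, (∀ y z, Z y ≠ 0 → Z z ≠ 0 → T g y / Z y = T g z / Z z) →
      ∃ κ, ∀ y, T g y = κ * Z y := by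
    intro g hg
    by_cases hy : ∃ y, Z y ≠ 0
    · obtain ⟨y, hy⟩ := hy
      refine ⟨T g y / Z y, fun z => ?_⟩
      by_cases hz : Z z = 0
      · rw [hz, hZ0 z hz, mul_zero]
      · rw [hg y z hy hz, div_mul_cancel₀ _ hz]
    · push Not at hy
      exact ⟨0, fun z => by rw [hZ0 z (hy z), zero_mul]⟩
  have h6 : ∀ (g : X → ℝ) (U : Y → ℝ), (∀ y z, Z y ≠ 0 → Z z ≠ 0 → T g y / Z y = T g z / Z z) →
      (∑ x, m x * (U (c x) * g x)) * (∑ x, m x) = (∑ x, m x * U (c x)) * (∑ x, m x * g x) := by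
    intro g U hg
    obtain ⟨κ, hκ⟩ := h5 g hg
    have e1 : ∑ x, m x = ∑ y, Z y := by simpa using hZ fun _ => 1
    have e2 : ∑ x, m x * g x = ∑ y, T g y := by simpa using hT g fun _ => 1
    rw [hT, hZ, e1, e2]
    simp only [hκ, ← Finset.mul_sum, mul_left_comm _ κ]
    ring
  refine h4.imp (fun hA => ?_) (fun hB => h6 B V hB)
  simpa only [mul_comm (A _), mul_comm (∑ x, m x * A x)] using h6 A U hA

/-! ### Completeness of d-separation for a single binary network -/

namespace Digraph

variable {W : Type*} [Fintype W]

theorem exists_sink {D : Digraph W} (hD : D.IsAcyclicDigraph) {S : Finset W} (hS : S.Nonempty) :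
    ∃ s ∈ S, ∀ w ∈ S, ¬ D.Adj s w := by
  let r : W → W → Prop := fun u v => Relation.TransGen D.Adj v u
  have : IsTrans W r := ⟨fun a b c hab hbc => hbc.trans hab⟩
  have : Std.Irrefl r := ⟨hD⟩
  obtain ⟨s, hs, hmin⟩ := (Finite.wellFounded_of_trans_of_irrefl r).has_min (S : Set W) hS
  exact ⟨s, hs, fun w hw h => hmin w hw (.single h)⟩

variable [DecidableEq W]

/-- At a generic positive `θ` for the smaller network, `a` is correlated with the parent `u` and `b`
with the parent `w`. If the covariance of `a` and `b` vanished for every parameter of `s`, it would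
vanish under every reweighting by the parents, contradicting one of these correlations. -/
theorem exists_condCov_ne_zero_of_sink_mem (D : Digraph W) {S : Finset W} {C : Set W} {s : W}
    (hs : s ∈ S) (hsC : s ∈ C) {a b u w : W} (hu : D.Adj u s) (hw : D.Adj w s)
    (hau : ∃ θ, D.condCov θ (S.erase s) C a u ≠ 0) (hwb : ∃ θ, D.condCov θ (S.erase s) C w b ≠ 0) :
    ∃ θ, D.condCov θ S C a b ≠ 0 := by
  obtain ⟨θ, hθ, hne⟩ := exists_forall_ne_zero_of_analytic
    (F := fun (i : Bool) θ => if i then D.condCov θ (S.erase s) C a u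
      else D.condCov θ (S.erase s) C w b)
    (fun i => by cases i <;> simpa using D.analyticOnNhd_condCov analyticOnNhd_param _ _)
    (fun i => by cases i <;> simpa) (isOpen_openParams W) ⟨_, half_mem_openParams W⟩
  by_contra hcon
  push Not at hcon
  have hf : ∀ (f : (W → Bool) → ℝ) (g : (W → Bool) → ℝ),
      D.condSum (Function.update θ s f) S C g
        = D.condSum θ (S.erase s) C (fun x => f (D.parentConfig s x) * g x) := fun f g => by
    rw [D.condSum_of_mem hs hsC, D.condSum_update_param (Finset.notMem_erase s S)]
    simp only [Function.update_self]
  have hcoord : ∀ {v : W}, D.Adj v s → ∀ x, coordInd v (D.parentConfig s x) = coordInd v x :=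
    fun hv x => by simp [coordInd, parentConfig, hv]
  have key := uncorrelated_of_forall_reweight (A := coordInd a) (B := coordInd b)
    (m := fun x => trueOn C x * ∏ v ∈ S.erase s, D.kernel θ v x)
    (fun x => mul_nonneg (trueOn_nonneg C x) (D.prod_kernel_pos hθ x).le) (D.parentConfig s)
    (fun f => by
      have := hcon (Function.update θ s f)
      rw [condCov, sub_eq_zero] at this
      simp only [hf, mul_one] at this
      exact this) (coordInd u) (coordInd w)
  simp only [hcoord hu, hcoord hw] at key
  rcases key with h | h
  · refine hne true ?_
    simpa only [if_true, condCov, condSum, mul_one, sub_eq_zero] using h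
  · refine hne false ?_
    simpa only [Bool.false_eq_true, if_false, condCov, condSum, mul_one, sub_eq_zero] using h

/-- Completeness of d-separation for binary networks, in terms of the Bayes ball. -/
theorem exists_condCov_ne_zero {D : Digraph W} (hD : D.IsAcyclicDigraph) {C : Set W}
    (S : Finset W) {a b : W} (ha : a ∉ C) (hb : b ∉ C) {d : Bool}
    (h : BallReach (restrictRel D.Adj S) C (a, true) (b, d)) :
    ∃ θ, D.condCov θ S C a b ≠ 0 := by
  induction hn : S.card generalizing S a b d with
  | zero =>
    obtain rfl := Finset.card_eq_zero.1 hn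
    rcases Relation.ReflTransGen.cases_head h with h | ⟨st, h, -⟩
    · obtain rfl : a = b := congrArg Prod.fst h
      exact ⟨_, (D.condCov_self_pos (half_mem_openParams W) ha).ne'⟩
    · cases h with
      | up _ h => simpa using h.2.1
      | down _ _ h => simpa using h.2.1
  | succ n ih =>
    by_cases hab : a = b
    · subst hab
      exact ⟨_, (D.condCov_self_pos (half_mem_openParams W) ha).ne'⟩
    obtain ⟨s, hs, hsS⟩ := exists_sink hD (S := S) (Finset.card_pos.1 (by omega))
    have hcard : (S.erase s).card = n := by rw [Finset.card_erase_of_mem hs, hn]; rfl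
    have hss : ¬ D.Adj s s := hsS s hs
    have hset : ((S : Set W) \ {s}) = (S.erase s : Finset W) := (Finset.coe_erase s S).symm
    have hone : ∀ (x : W → Bool) (b : Bool), (fun _ => 1 : (W → Bool) → ℝ) (Function.update x s b)
      = (fun _ => 1 : (W → Bool) → ℝ) x := fun _ _ => rfl
    by_cases hsC : s ∈ C
    · have has : a ≠ s := by rintro rfl; exact ha hsC
      rcases BallReach.diff_sink_of_mem hsS h has with ⟨-, h⟩ | ⟨u, -, hu, huC, ⟨d', hau⟩, h⟩
      · rw [hset] at h
        obtain ⟨θ, hθ⟩ := ih _ ha hb h hcard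
        -- With the parameter 1 the conditioned sink contributes the factor 1 and disappears.
        refine ⟨Function.update θ s fun _ => 1, ?_⟩
        simpa only [condCov, D.condSum_of_mem hs hsC, Function.update_self, one_mul,
          D.condSum_update_param (Finset.notMem_erase s S)] using hθ
      · rcases h with h | ⟨-, w, -, hw, h⟩
        · obtain rfl : b = s := congrArg Prod.fst h
          exact absurd hsC hb
        · rw [hset] at h hau
          -- A ball that comes from a child to a vertex in `C` is stuck, so it would have to end
          -- there, but `b ∉ C`.
          have hwC : w ∉ C := fun hwC => by
            obtain rfl : b = w := congrArg Prod.fst (BallReach.eq_of_mem hwC h)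
            exact hb hwC
          exact D.exists_condCov_ne_zero_of_sink_mem hs hsC hu hw (ih _ ha huC hau hcard)
            (ih _ hwC hb h hcard)
    · have sink : ∀ {v w : W}, v ≠ s → D.Adj w s → (∃ θ, D.condCov θ (S.erase s) C v w ≠ 0) →
          ∃ θ, D.condCov θ S C v s ≠ 0 := by
        rintro v w hv hw ⟨θ, hθ⟩
        -- This makes `s` a copy of its parent `w`. Parameters 0 and 1 are harmless, since only a
        -- nonzero value of the polynomial is sought.
        refine ⟨Function.update θ s (coordInd w), ?_⟩
        have hw' : ∀ x, coordInd w (D.parentConfig s x) = coordInd w x :=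
          fun x => by simp [coordInd, parentConfig, hw]
        have h1 := D.condSum_mul_coordInd_of_sink (θ := Function.update θ s (coordInd w)) hs hsC hsS
          (g := fun _ => 1) hone
        have h2 := D.condSum_mul_coordInd_of_sink (θ := Function.update θ s (coordInd w)) hs hsC hsS
          (coordInd_update hv)
        simp only [one_mul, Function.update_self, hw'] at h1 h2
        rw [condCov, h1, h2, D.condSum_of_sink_of_update hs hsC hsS (coordInd_update hv),
          D.condSum_of_sink_of_update hs hsC hsS hone]
        simp only [D.condSum_update_param (Finset.notMem_erase s S)]
        intro h0
        refine hθ ?_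
        unfold condCov
        linear_combination 4 * h0
      by_cases hbs : b = s
      · subst hbs
        obtain ⟨w, -, hw, hwC, d', h⟩ := BallReach.exists_parent_of_sink hsS hsC h hab
        rw [hset] at h
        exact sink hab hw (ih _ ha hwC h hcard)
      by_cases has : a = s
      · subst has
        rcases Relation.ReflTransGen.cases_head h with h | ⟨st, hst, h⟩
        · exact absurd (congrArg Prod.fst h) hab
        · cases hst with
          | @up u _ _ hu =>
            have hua : u ≠ a := by rintro rfl; exact hss hu.1
            have huC : u ∉ C := fun huC => by
              obtain rfl : b = u := congrArg Prod.fst (BallReach.eq_of_mem huC h)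
              exact hb huC
            rcases BallReach.diff_sink hsS hsC h hua with h | ⟨-, h⟩
            · exact absurd (congrArg Prod.fst h) hbs
            · rw [hset] at h
              obtain ⟨θ, hθ⟩ := ih _ huC hb h hcard
              rw [D.condCov_comm] at hθ
              obtain ⟨θ', hθ'⟩ := sink hbs hu.1 ⟨θ, hθ⟩
              exact ⟨θ', D.condCov_comm a b ▸ hθ'⟩
          | down _ _ hw => exact absurd hw.1 (hsS _ hw.2.2)
      · rcases BallReach.diff_sink hsS hsC h has with h | ⟨-, h⟩
        · exact absurd (congrArg Prod.fst h) hbs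
        · rw [hset] at h
          obtain ⟨θ, hθ⟩ := ih _ ha hb h hcard
          refine ⟨θ, ?_⟩
          rw [condCov, D.condSum_of_sink_of_update hs hsC hsS (coordInd_update has),
            D.condSum_of_sink_of_update hs hsC hsS (coordInd_update hbs),
            D.condSum_of_sink_of_update hs hsC hsS (g := fun _ => 1) hone,
            D.condSum_of_sink_of_update hs hsC hsS
              (g := fun x => coordInd a x * coordInd b x) (fun x c => by
                rw [coordInd_update has, coordInd_update hbs])]
          intro h0
          refine hθ ?_
          unfold condCov
          linear_combination 4 * h0

/-- The total mass of a binary network. -/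
theorem condSum_empty_one {D : Digraph W} (hD : D.IsAcyclicDigraph) (θ : W → (W → Bool) → ℝ) :
    D.condSum θ Finset.univ ∅ (fun _ => 1) = 1 := by
  have : ∀ n, ∀ S : Finset W, S.card = n →
      D.condSum θ S ∅ (fun _ => 1) = (1 / 2) ^ n * 2 ^ Fintype.card W := by
    intro n
    induction n with
    | zero =>
      intro S hS
      obtain rfl := Finset.card_eq_zero.1 hS
      simp [condSum, trueOn]
    | succ n ih =>
      intro S hS
      obtain ⟨s, hs, hsS⟩ := exists_sink hD (S := S) (Finset.card_pos.1 (by omega))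
      rw [D.condSum_of_sink_of_update hs (Set.notMem_empty s) hsS (fun _ _ => rfl),
        ih _ (by rw [Finset.card_erase_of_mem hs, hS]; rfl)]
      ring
  rw [this _ Finset.univ rfl, Finset.card_univ, ← mul_pow]
  norm_num

end Digraph

/-! ### Bayes ball in a mixture DAG -/

namespace MixtureDAG

variable {V : Type*} {K : ℕ} (G : MixtureDAG V K)

/-- The `i`-th component DAG together with the node `y`. -/
def withSource (i : Fin K) : Digraph (Option V) where
  Adj
    | some u, some v => (G.component i).Adj u v
    | none, some v => v ∉ G.inv
    | _, none => False

theorem withSource_isAcyclic (i : Fin K) : (G.withSource i).IsAcyclicDigraph := by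
  have key : ∀ u x, Relation.TransGen (G.withSource i).Adj (some u) x →
      ∃ v, x = some v ∧ Relation.TransGen (G.component i).Adj u v := by
    intro u x h
    induction h with
    | @single x h =>
      match x, h with
      | some v, h => exact ⟨v, rfl, .single h⟩
    | @tail y x _ h ih =>
      obtain ⟨v, rfl, hv⟩ := ih
      match x, h with
      | some w, h => exact ⟨w, rfl, hv.tail h⟩
  intro w h
  match w with
  | some v =>
    obtain ⟨v', hv', h⟩ := key v _ h
    obtain rfl := Option.some_injective _ hv'
    exact G.acyclic i v h
  | none =>
    obtain ⟨x, -, hx⟩ := Relation.TransGen.tail'_iff.1 h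
    match x, hx with
    | some _, hx => exact hx
    | none, hx => exact hx

theorem graph_asymm (u v : Option (V × Fin K)) (h : G.graph.Adj u v) : ¬ G.graph.Adj v u := by
  intro h'
  match u, v, h, h' with
  | some (u, i), some (v, j), h, h' =>
    obtain ⟨rfl, h⟩ := h
    exact G.acyclic i u (.tail (.single h) h'.2)
  | none, some _, _, h' => exact h'
  | some _, none, h, _ => exact h
  | none, none, h, _ => exact h

variable {G} {C : Set V}

theorem some_mem_copies {v : V} {j : Fin K} : some (v, j) ∈ copies K C ↔ v ∈ C := by
  simp [copies]

theorem not_mem_image_some {v : V} (h : v ∉ C) : some v ∉ some '' C := by simpa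

theorem BallStep.withSource {i : Fin K} {v w : V} {d d' : Bool}
    (h : BallStep (G.component i).Adj C (v, d) (w, d')) :
    BallStep (G.withSource i).Adj (some '' C) (some v, d) (some w, d') := by
  cases h with
  | up hv h => exact .up (not_mem_image_some hv) h
  | down d hv h => exact .down d (not_mem_image_some hv) h
  | bounce hv h => exact .bounce (Set.mem_image_of_mem _ hv) h

theorem BallReach.withSource {i : Fin K} {v w : V} {d d' : Bool}
    (h : BallReach (G.component i).Adj C (v, d) (w, d')) :
    BallReach (G.withSource i).Adj (some '' C) (some v, d) (some w, d') :=
  Relation.ReflTransGen.lift (fun st : V × Bool => (some st.1, st.2))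
    (fun _ _ h => BallStep.withSource h) _ _ h

theorem BallStep.of_graph {i j : Fin K} {v w : V} {d d' : Bool}
    (h : BallStep G.graph.Adj (copies K C) (some (v, i), d) (some (w, j), d')) :
    i = j ∧ BallStep (G.component i).Adj C (v, d) (w, d') := by
  cases h with
  | up hv h =>
    obtain ⟨rfl, h⟩ := h
    exact ⟨rfl, .up (mt some_mem_copies.2 hv) h⟩
  | down d hv h =>
    obtain ⟨rfl, h⟩ := h
    exact ⟨rfl, .down d (mt some_mem_copies.2 hv) h⟩
  | bounce hv h =>
    obtain ⟨rfl, h⟩ := h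
    exact ⟨rfl, .bounce (some_mem_copies.1 hv) h⟩

/-- The ball moves within one component, or else it passes through `y`. -/
theorem ballReach_graph {a : V} {i : Fin K} {st : Option (V × Fin K) × Bool}
    (h : BallReach G.graph.Adj (copies K C) (some (a, i), true) st) :
    (∀ v j d, st = (some (v, j), d) →
      (j = i ∧ BallReach (G.component i).Adj C (a, true) (v, d)) ∨
      (BallReach (G.withSource i).Adj (some '' C) (some a, true) (none, true) ∧
        BallReach (G.withSource j).Adj (some '' C) (none, true) (some v, d))) ∧
    (∀ d, st = (none, d) → d = true ∧
      BallReach (G.withSource i).Adj (some '' C) (some a, true) (none, true)) := by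
  induction h with
  | refl =>
    refine ⟨?_, fun d h => by simp at h⟩
    rintro v j d ⟨⟩
    exact .inl ⟨rfl, .refl⟩
  | @tail x y _ hstep ih =>
    refine ⟨?_, ?_⟩
    · rintro w j d' rfl
      match x, hstep, ih with
      | (some (v, k), d), hstep, ih =>
        obtain ⟨rfl, hs⟩ := BallStep.of_graph hstep
        rcases ih.1 v k d rfl with ⟨rfl, h⟩ | ⟨h, h'⟩
        · exact .inl ⟨rfl, h.tail hs⟩
        · exact .inr ⟨h, h'.tail (BallStep.withSource hs)⟩
      | (none, d), hstep, ih =>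
        obtain ⟨rfl, h⟩ := ih.2 d rfl
        refine .inr ⟨h, .single ?_⟩
        cases hstep with
        | up _ h => exact h.elim
        | down d _ h => exact .down _ (by simp) h
    · rintro d' rfl
      match x, hstep, ih with
      | (none, d), hstep, ih =>
        cases hstep with
        | up _ h => exact h.elim
        | down d _ h => exact h.elim
        | bounce _ h => exact h.elim
      | (some (v, k), d), hstep, ih =>
        have hsrc : d' = true ∧ (G.withSource k).Adj none (some v) ∧
            BallStep (G.withSource k).Adj (some '' C) (some v, d) (none, true) := by
          cases hstep with
          | up hv h =>
            exact ⟨rfl, h, .up (not_mem_image_some (mt some_mem_copies.2 hv)) h⟩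
          | down d _ h => exact h.elim
          | bounce hv h =>
            exact ⟨rfl, h, .bounce (Set.mem_image_of_mem _ (some_mem_copies.1 hv)) h⟩
        obtain ⟨rfl, -, hs⟩ := hsrc
        refine ⟨rfl, ?_⟩
        -- On a return to `y` the loop since the earlier visit is discarded.
        rcases ih.1 v k d rfl with ⟨rfl, h⟩ | ⟨h, -⟩
        · exact (BallReach.withSource h).tail hs
        · exact h

/-! ### Mixtures of binary networks -/

open Classical in
/-- The parameters of the `j`-th component: those of the invariant nodes are shared. -/
noncomputable def tie (G : MixtureDAG V K) (j₀ : Fin K) (θ : Fin K → V → (V → Bool) → ℝ)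
    (j : Fin K) : V → (V → Bool) → ℝ :=
  fun v => if v ∈ G.inv then θ j₀ v else θ j v

theorem tie_mem_openParams (j₀ : Fin K) {θ : Fin K → V → (V → Bool) → ℝ}
    (hθ : ∀ j, θ j ∈ openParams V) (j : Fin K) : G.tie j₀ θ j ∈ openParams V := by
  intro v π
  unfold tie
  split_ifs
  exacts [hθ j₀ v π, hθ j v π]

open Classical in
/-- The parameters of the network on `V` for a fixed value of `y`. -/
noncomputable def slice (G : MixtureDAG V K) (θ : Option V → (Option V → Bool) → ℝ) (y : Bool) :
    V → (V → Bool) → ℝ :=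
  fun v π => θ (some v) fun o => o.elim (decide (v ∉ G.inv) && y) π

theorem slice_eq_of_mem (θ : Option V → (Option V → Bool) → ℝ) (y y' : Bool) {v : V}
    (hv : v ∈ G.inv) : G.slice θ y v = G.slice θ y' v := by
  funext π
  simp [slice, hv]

variable [Fintype V] [DecidableEq V]

/-- The weighted sum of `g` over the configurations that are `true` on `C`, in a component. -/
noncomputable def compSum (G : MixtureDAG V K) (j₀ : Fin K) (θ : Fin K → V → (V → Bool) → ℝ)
    (C : Set V) (j : Fin K) (g : (V → Bool) → ℝ) : ℝ :=
  (G.component j).condSum (G.tie j₀ θ j) Finset.univ C g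

/-- The weighted sum of `g` over the configurations that are `true` on `C`, in the mixture. -/
noncomputable def mixSum (G : MixtureDAG V K) (j₀ : Fin K) (θ : Fin K → V → (V → Bool) → ℝ)
    (w : Fin K → ℝ) (C : Set V) (g : (V → Bool) → ℝ) : ℝ :=
  ∑ j, w j * G.compSum j₀ θ C j g

/-- The (unnormalized) covariance of `x a` and `x b` given that `x` is `true` on `C`. -/
noncomputable def mixCov (G : MixtureDAG V K) (j₀ : Fin K) (θ : Fin K → V → (V → Bool) → ℝ)
    (w : Fin K → ℝ) (C : Set V) (a b : V) : ℝ :=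
  G.mixSum j₀ θ w C (fun x => coordInd a x * coordInd b x) * G.mixSum j₀ θ w C (fun _ => 1) -
    G.mixSum j₀ θ w C (coordInd a) * G.mixSum j₀ θ w C (coordInd b)

/-- The (unnormalized) difference of the conditional probabilities of `x a` in two components. -/
noncomputable def compDiff (G : MixtureDAG V K) (j₀ : Fin K) (θ : Fin K → V → (V → Bool) → ℝ)
    (C : Set V) (i k : Fin K) (a : V) : ℝ :=
  G.compSum j₀ θ C i (coordInd a) * G.compSum j₀ θ C k (fun _ => 1) -
    G.compSum j₀ θ C k (coordInd a) * G.compSum j₀ θ C i (fun _ => 1)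

theorem analyticOnNhd_tie (j₀ j : Fin K) (v : V) (π : V → Bool) :
    AnalyticOnNhd ℝ (fun θ : Fin K → V → (V → Bool) → ℝ => G.tie j₀ θ j v π) Set.univ := by
  have h : ∀ k : Fin K, AnalyticOnNhd ℝ (fun θ : Fin K → V → (V → Bool) → ℝ => θ k v π) Set.univ :=
    fun k => (analyticOnNhd_param v π).comp
      (fun θ _ => (ContinuousLinearMap.proj (R := ℝ)
        (φ := fun _ : Fin K => V → (V → Bool) → ℝ) k).analyticAt θ) (Set.mapsTo_univ _ _)
  unfold tie
  split_ifs
  exacts [h j₀, h j]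

theorem analyticOnNhd_compSum (j₀ j : Fin K) (g : (V → Bool) → ℝ) :
    AnalyticOnNhd ℝ (fun θ => G.compSum j₀ θ C j g) Set.univ :=
  (G.component j).analyticOnNhd_condSum (analyticOnNhd_tie j₀ j) g

theorem analyticOnNhd_compDiff (j₀ i k : Fin K) (a : V) :
    AnalyticOnNhd ℝ (fun θ => G.compDiff j₀ θ C i k a) Set.univ :=
  ((analyticOnNhd_compSum _ _ _).mul (analyticOnNhd_compSum _ _ _)).sub
    ((analyticOnNhd_compSum _ _ _).mul (analyticOnNhd_compSum _ _ _))

theorem analyticOnNhd_mixSum (j₀ : Fin K) (g : (V → Bool) → ℝ) :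
    AnalyticOnNhd ℝ (fun p : (Fin K → V → (V → Bool) → ℝ) × (Fin K → ℝ) =>
      G.mixSum j₀ p.1 p.2 C g) Set.univ := by
  refine Finset.analyticOnNhd_fun_sum _ fun j _ => AnalyticOnNhd.mul ?_ ?_
  · exact fun p _ => ((ContinuousLinearMap.proj (R := ℝ) (φ := fun _ : Fin K => ℝ) j).comp
      (ContinuousLinearMap.snd ℝ _ _)).analyticAt p
  · exact (analyticOnNhd_compSum j₀ j g).comp analyticOnNhd_fst (Set.mapsTo_univ _ _)

theorem analyticOnNhd_mixCov (j₀ : Fin K) (a b : V) :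
    AnalyticOnNhd ℝ (fun p : (Fin K → V → (V → Bool) → ℝ) × (Fin K → ℝ) =>
      G.mixCov j₀ p.1 p.2 C a b) Set.univ :=
  ((analyticOnNhd_mixSum _ _).mul (analyticOnNhd_mixSum _ _)).sub
    ((analyticOnNhd_mixSum _ _).mul (analyticOnNhd_mixSum _ _))

/-- The law of total probability for the value of `y`, which has no parents. As `y` does not point
to invariant nodes, `slice` gives them the same parameters for both values. -/
theorem condSum_withSource (i : Fin K) (θ : Option V → (Option V → Bool) → ℝ)
    (g : (Option V → Bool) → ℝ) :
    (G.withSource i).condSum θ Finset.univ (some '' C) g =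
      θ none (fun _ => false) * (G.component i).condSum (G.slice θ true) Finset.univ C
        (fun x => g fun o => o.elim true x) +
      (1 - θ none (fun _ => false)) * (G.component i).condSum (G.slice θ false) Finset.univ C
        (fun x => g fun o => o.elim false x) := by
  classical
  let e : Bool × (V → Bool) ≃ (Option V → Bool) :=
    (Equiv.piOptionEquivProd (β := fun _ : Option V => Bool)).symm
  have he : ∀ y x, e (y, x) = fun o => o.elim y x := by
    intro y x
    funext o
    cases o <;> rfl
  have htrue : ∀ y x, trueOn (some '' C) (e (y, x)) = trueOn C x := by
    intro y x
    simp [trueOn, he]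
  have hnone : ∀ y x, (G.withSource i).kernel θ none (e (y, x))
      = bernoulliWeight (θ none fun _ => false) y := by
    intro y x
    have : (G.withSource i).parentConfig none (e (y, x)) = fun _ => false := by
      funext o
      exact Digraph.parentConfig_of_not_adj _ (by cases o <;> exact id) _
    rw [Digraph.kernel, this, he]
    rfl
  have hsome : ∀ y x v, (G.withSource i).kernel θ (some v) (e (y, x))
      = (G.component i).kernel (G.slice θ y) v x := by
    intro y x v
    have : (G.withSource i).parentConfig (some v) (e (y, x)) =
        fun o => o.elim (decide (v ∉ G.inv) && y) ((G.component i).parentConfig v x) := by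
      funext o
      rw [he]
      cases o with
      | none =>
        by_cases hv : v ∈ G.inv
        · rw [Digraph.parentConfig_of_not_adj (G.withSource i) (u := none) (v := some v) (fun h => h hv)]
          simp [hv]
        · rw [Digraph.parentConfig_of_adj (G.withSource i) (u := none) (v := some v) hv]
          simp [hv]
      | some u =>
        by_cases hu : (G.component i).Adj u v
        · exact (Digraph.parentConfig_of_adj (G.withSource i) (u := some u) (v := some v) hu _).trans
            (Digraph.parentConfig_of_adj _ hu _).symm
        · exact (Digraph.parentConfig_of_not_adj (G.withSource i) (u := some u) (v := some v) hu _).trans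
            (Digraph.parentConfig_of_not_adj _ hu _).symm
    rw [Digraph.kernel, this, he]
    rfl
  rw [Digraph.condSum, ← e.sum_comp, Fintype.sum_prod_type]
  simp only [Fintype.prod_option, htrue, hnone, hsome]
  simp only [Fintype.sum_bool, Digraph.condSum, Finset.mul_sum, he]
  congr 1
  · refine Finset.sum_congr rfl fun x _ => ?_
    simp only [bernoulliWeight, if_true]
    ring
  · refine Finset.sum_congr rfl fun x _ => ?_
    simp only [bernoulliWeight, Bool.false_eq_true, if_false]
    ring

/-- A correlation of `x a` with `y` says that the two values of `y` give two networks on the `i`-th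
component with different conditional probabilities of `x a`. At most one of these agrees with the
`k`-th component. The two networks share the parameters of the invariant nodes, so both respect the
tying. -/
theorem exists_compDiff_ne_zero (j₀ : Fin K) {i k : Fin K} (hik : i ≠ k) {a : V}
    (h : ∃ θ, (G.withSource i).condCov θ Finset.univ (some '' C) (some a) none ≠ 0) :
    ∃ θ, G.compDiff j₀ θ C i k a ≠ 0 := by
  obtain ⟨θ, hθ, hne⟩ := exists_forall_ne_zero_of_analytic (ι := Unit)
    (fun _ => (G.withSource i).analyticOnNhd_condCov (S := Finset.univ) (C := some '' C)
      analyticOnNhd_param (some a) none)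
    (fun _ => h) (isOpen_openParams (Option V)) ⟨_, half_mem_openParams _⟩
  have hne := hne ()
  let Z (y : Bool) := (G.component i).condSum (G.slice θ y) Finset.univ C fun _ => 1
  let A (y : Bool) := (G.component i).condSum (G.slice θ y) Finset.univ C (coordInd a)
  -- The covariance of `x a` and `y` is this determinant times `t * (1 - t)`, where `t` is the
  -- probability of `y = true`.
  have h1 : A true * Z false - A false * Z true ≠ 0 := by
    intro h0
    refine hne ?_
    have hzero : ∀ y, (G.component i).condSum (G.slice θ y) Finset.univ C (fun _ => 0) = 0 :=
      fun y => by simp [Digraph.condSum]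
    have ha : ∀ y (x : V → Bool), coordInd (some a) (fun o => Option.elim o y x) = coordInd a x :=
      fun _ _ => rfl
    have ht : ∀ x : V → Bool, coordInd none (fun o : Option V => Option.elim o true x) = 1 :=
      fun _ => rfl
    have hf : ∀ x : V → Bool, coordInd none (fun o : Option V => Option.elim o false x) = 0 :=
      fun _ => rfl
    simp only [Digraph.condCov, condSum_withSource, ha, ht, hf, mul_one, mul_zero, hzero]
    linear_combination θ none (fun _ => false) * (1 - θ none (fun _ => false)) * h0
  -- Only the `i`-th component sees the value of `y`; all others are frozen at `true`.
  let η (y : Bool) : Fin K → V → (V → Bool) → ℝ :=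
    fun j => if j = i then G.slice θ y else G.slice θ true
  have hinv : ∀ y j v, v ∈ G.inv → η y j v = G.slice θ true v := by
    intro y j v hv
    simp only [η]
    split_ifs
    exacts [slice_eq_of_mem θ _ _ hv, rfl]
  have htie : ∀ y j, G.tie j₀ (η y) j = η y j := by
    intro y j
    funext v
    unfold tie
    split_ifs with hv
    · rw [hinv y _ v hv, hinv y _ v hv]
    · rfl
  have hi : ∀ y g, G.compSum j₀ (η y) C i g
      = (G.component i).condSum (G.slice θ y) Finset.univ C g := by
    intro y g
    rw [compSum, htie]
    simp [η]
  have hk : ∀ y g, G.compSum j₀ (η y) C k g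
      = (G.component k).condSum (G.slice θ true) Finset.univ C g := by
    intro y g
    rw [compSum, htie]
    simp [η, hik.symm]
  have hpos : 0 < (G.component k).condSum (G.slice θ true) Finset.univ C (fun _ => 1) :=
    (G.component k).condSum_one_pos fun v π => hθ _ _
  by_contra hcon
  push Not at hcon
  have ht := hcon (η true)
  have hf := hcon (η false)
  simp only [compDiff, hi, hk] at ht hf
  refine h1 ((mul_eq_zero.1 ?_).resolve_right hpos.ne')
  simp only [A, Z]
  linear_combination ((G.component i).condSum (G.slice θ false) Finset.univ C fun _ => 1) * ht -
    ((G.component i).condSum (G.slice θ true) Finset.univ C fun _ => 1) * hf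

theorem mixSum_two (j₀ : Fin K) (θ : Fin K → V → (V → Bool) → ℝ) {i k : Fin K} (hik : i ≠ k)
    (r s : ℝ) (g : (V → Bool) → ℝ) :
    G.mixSum j₀ θ (fun j => if j = i then r else if j = k then s else 0) C g
      = r * G.compSum j₀ θ C i g + s * G.compSum j₀ θ C k g := by
  have : ∀ j, (if j = i then r else if j = k then s else 0) * G.compSum j₀ θ C j g
      = (if j = i then r * G.compSum j₀ θ C j g else 0)
        + if j = k then s * G.compSum j₀ θ C j g else 0 := by
    intro j
    by_cases hi : j = i
    · subst hi; simp [hik]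
    · simp [hi]
  simp [mixSum, this, Finset.sum_add_distrib]

/-- With one generic `θ` for both differences, the weights `(1, 0)`, `(0, 1)`, `(1, 1)` on `i` and
`k` cannot all give covariance zero, by polarization. -/
theorem exists_mixCov_ne_zero_of_compDiff (j₀ : Fin K) {i k : Fin K} (hik : i ≠ k) {a b : V}
    (ha : ∃ θ, G.compDiff j₀ θ C i k a ≠ 0) (hb : ∃ θ, G.compDiff j₀ θ C i k b ≠ 0) :
    ∃ θ w, G.mixCov j₀ θ w C a b ≠ 0 := by
  obtain ⟨θ, -, hne⟩ := exists_forall_ne_zero_of_analytic (ι := Bool)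
    (F := fun c θ => G.compDiff j₀ θ C i k (if c then a else b))
    (fun c => analyticOnNhd_compDiff j₀ i k _)
    (fun c => by cases c <;> simpa) isOpen_univ Set.univ_nonempty
  refine ⟨θ, ?_⟩
  by_contra hcon
  push Not at hcon
  have h (r s : ℝ) := hcon fun j => if j = i then r else if j = k then s else 0
  simp only [mixCov, mixSum_two j₀ θ hik] at h
  have h10 := sub_eq_zero.1 (h 1 0)
  have h01 := sub_eq_zero.1 (h 0 1)
  have h11 := sub_eq_zero.1 (h 1 1)
  simp only [one_mul, zero_mul, add_zero, zero_add] at h10 h01 h11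
  refine mul_ne_zero (hne true) (hne false) ?_
  simpa [compDiff] using polarized_det_eq_zero h10 h01 h11

/-- Completeness of d-separation for mixtures of binary networks. -/
theorem exists_mixCov_ne_zero (j₀ : Fin K) {a b : V} (ha : a ∉ C) (hb : b ∉ C)
    {i j : Fin K} {d : Bool}
    (h : BallReach G.graph.Adj (copies K C) (some (a, i), true) (some (b, j), d)) :
    ∃ θ w, G.mixCov j₀ θ w C a b ≠ 0 := by
  have huniv : ∀ {W : Type _} [Fintype W] (D : Digraph W),
      restrictRel D.Adj ((Finset.univ : Finset W) : Set W) = D.Adj := by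
    intro W _ D
    funext u v
    simp [restrictRel]
  rcases (ballReach_graph h).1 b j d rfl with ⟨-, h⟩ | ⟨hay, hyb⟩
  · rw [← huniv] at h
    obtain ⟨θ, hθ⟩ := Digraph.exists_condCov_ne_zero (G.acyclic i) Finset.univ ha hb h
    refine ⟨fun _ => θ, fun k => if k = i then 1 else 0, ?_⟩
    have htie : G.tie j₀ (fun _ => θ) i = θ := by
      funext v
      simp [tie]
    simpa [mixCov, mixSum, compSum, htie, Digraph.condCov] using hθ
  · have hinv : G.inv ≠ Set.univ := by
      intro hinv
      rcases Relation.ReflTransGen.cases_head hyb with h | ⟨⟨x, e⟩, h, -⟩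
      · simp at h
      · match x, h with
        | none, h => cases h <;> simp_all [withSource]
        | some v, h => cases h <;> simp_all [withSource]
    rw [← huniv] at hay hyb
    have hnone : (none : Option V) ∉ some '' C := by simp
    have h1 := Digraph.exists_condCov_ne_zero (G.withSource_isAcyclic i) Finset.univ
      (not_mem_image_some ha) hnone hay
    have h2 := Digraph.exists_condCov_ne_zero (G.withSource_isAcyclic j) Finset.univ
      hnone (not_mem_image_some hb) hyb
    simp only [Digraph.condCov_comm _ none] at h2
    by_cases hij : i = j
    · subst hij
      have : Nontrivial (Fin K) := by
        rw [Fin.nontrivial_iff_two_le]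
        have := i.pos
        have := mt G.inv_of_single hinv
        omega
      obtain ⟨k, hk⟩ := exists_ne i
      exact exists_mixCov_ne_zero_of_compDiff j₀ hk.symm (exists_compDiff_ne_zero j₀ hk.symm h1)
        (exists_compDiff_ne_zero j₀ hk.symm h2)
    · refine exists_mixCov_ne_zero_of_compDiff j₀ hij (exists_compDiff_ne_zero j₀ hij h1) ?_
      obtain ⟨θ, hθ⟩ := exists_compDiff_ne_zero j₀ (Ne.symm hij) h2
      refine ⟨θ, fun h0 => hθ ?_⟩
      unfold compDiff at h0 ⊢
      linear_combination -h0

/-- Parameters of a binary mixture that is faithful and in which exactly the nodes in `G.inv` are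
invariant. -/
theorem exists_faithful_params (G : MixtureDAG V K) (j₀ : Fin K) :
    ∃ (θ : Fin K → V → (V → Bool) → ℝ) (w : Fin K → ℝ),
      (∀ j, θ j ∈ openParams V) ∧ (∀ j, 0 < w j) ∧
      (∀ v ∉ G.inv, ∃ j k, θ j v (fun _ => false) ≠ θ k v fun _ => false) ∧
      ∀ (C : Set V) (a b : V), a ∉ C → b ∉ C → ∀ i j d,
        BallReach G.graph.Adj (copies K C) (some (a, i), true) (some (b, j), d) →
        G.mixCov j₀ θ w C a b ≠ 0 := by
  classical
  let U : Set ((Fin K → V → (V → Bool) → ℝ) × (Fin K → ℝ)) :=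
    (Set.univ.pi fun _ => openParams V) ×ˢ (Set.univ.pi fun _ => Set.Ioi 0)
  have hU : IsOpen U := (isOpen_set_pi Set.finite_univ fun _ _ => isOpen_openParams V).prod
    (isOpen_set_pi Set.finite_univ fun _ _ => isOpen_Ioi)
  have hne : U.Nonempty := ⟨(fun _ _ _ => 1 / 2, fun _ => 1),
    fun _ _ => half_mem_openParams V, fun _ _ => Set.mem_Ioi.2 one_pos⟩
  let P (t : Set V × V × V) : Prop := t.2.1 ∉ t.1 ∧ t.2.2 ∉ t.1 ∧ ∃ i j d,
    BallReach G.graph.Adj (copies K t.1) (some (t.2.1, i), true) (some (t.2.2, j), d)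
  -- These further conditions separate the parameters of each node in different components, which
  -- will make the nodes outside `G.inv` non-invariant.
  let Q (t : V × Fin K × Fin K) : Prop := t.2.1 ≠ t.2.2
  obtain ⟨⟨θ, w⟩, ⟨hθ, hw⟩, h⟩ := exists_forall_ne_zero_of_analytic
    (F := fun (t : {t // P t} ⊕ {t // Q t}) (p : (Fin K → V → (V → Bool) → ℝ) × (Fin K → ℝ)) =>
      t.elim (fun t => G.mixCov j₀ p.1 p.2 t.1.1 t.1.2.1 t.1.2.2)
        (fun t => p.1 t.1.2.1 t.1.1 (fun _ => false) - p.1 t.1.2.2 t.1.1 fun _ => false))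
    (fun t => by
      rcases t with t | t
      · exact analyticOnNhd_mixCov j₀ _ _
      · have h : ∀ k : Fin K, AnalyticOnNhd ℝ (fun p : (Fin K → V → (V → Bool) → ℝ) × (Fin K → ℝ) =>
            p.1 k t.1.1 fun _ => false) Set.univ := fun k =>
          (analyticOnNhd_param t.1.1 fun _ => false).comp (fun p _ =>
            ((ContinuousLinearMap.proj (R := ℝ) (φ := fun _ : Fin K => V → (V → Bool) → ℝ) k).comp
              (ContinuousLinearMap.fst ℝ _ (Fin K → ℝ))).analyticAt p) (Set.mapsTo_univ _ _)
        exact (h _).sub (h _))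
    (fun t => by
      rcases t with ⟨t, ha, hb, i, j, d, hr⟩ | ⟨t, ht⟩
      · obtain ⟨θ, w, h⟩ := exists_mixCov_ne_zero j₀ ha hb hr
        exact ⟨(θ, w), h⟩
      · refine ⟨(fun k _ _ => if k = t.2.1 then 1 else 0, 0), ?_⟩
        have : t.2.2 ≠ t.2.1 := Ne.symm ht
        simp [this])
    hU hne
  refine ⟨θ, w, fun j => hθ j (Set.mem_univ j), fun j => hw j (Set.mem_univ j), ?_, ?_⟩
  · intro v hv
    have : Nontrivial (Fin K) := by
      rw [Fin.nontrivial_iff_two_le]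
      have := j₀.pos
      have := mt G.inv_of_single fun h => hv (h ▸ Set.mem_univ v)
      omega
    obtain ⟨k, hk⟩ := exists_ne j₀
    exact ⟨j₀, k, sub_ne_zero.1 (h (.inr ⟨(v, j₀, k), hk.symm⟩))⟩
  · exact fun C a b ha hb i j d hr => h (.inl ⟨(C, a, b), ha, hb, i, j, d, hr⟩)

end MixtureDAG

/-! ### Measures with a density that depends on signs -/

/-- The configuration of the signs of the coordinates. -/
noncomputable def signConfig {V : Type*} (x : V → ℝ) : V → Bool := fun v => decide (0 < x v)

/-- The density `exp (-|t|)`, restricted to the positive or to the nonpositive reals. -/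
noncomputable def halfDensity (b : Bool) (t : ℝ) : ℝ :=
  if decide (0 < t) = b then Real.exp (-|t|) else 0

theorem halfDensity_eq (b : Bool) : halfDensity b =
    if b then (Set.Ioi 0).indicator (fun t => Real.exp (-t))
      else (Set.Iic 0).indicator Real.exp := by
  funext t
  by_cases ht : 0 < t
  · cases b <;> simp [halfDensity, ht, abs_of_pos ht]
  · cases b <;> simp [halfDensity, ht, abs_of_nonpos (not_lt.1 ht), not_lt.1 ht]

theorem integrable_halfDensity (b : Bool) : Integrable (halfDensity b) := by
  rw [halfDensity_eq]
  cases b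
  · simpa using (integrable_indicator_iff measurableSet_Iic).2 (integrableOn_exp_Iic 0)
  · simpa using (integrable_indicator_iff measurableSet_Ioi).2 (integrableOn_exp_neg_Ioi 0)

theorem integral_halfDensity (b : Bool) : ∫ t, halfDensity b t = 1 := by
  rw [halfDensity_eq]
  cases b
  · simpa [integral_indicator measurableSet_Iic] using integral_exp_Iic_zero
  · simpa [integral_indicator measurableSet_Ioi] using integral_exp_neg_Ioi_zero

theorem lintegral_exp_mul_bernoulliWeight {p : ℝ} (h0 : 0 < p) (h1 : p < 1) :
    ∫⁻ t : ℝ, ENNReal.ofReal (Real.exp (-|t|) * bernoulliWeight p (decide (0 < t))) = 1 := by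
  have heq : ∀ t : ℝ, Real.exp (-|t|) * bernoulliWeight p (decide (0 < t))
      = p * halfDensity true t + (1 - p) * halfDensity false t := by
    intro t
    by_cases ht : 0 < t <;> simp [halfDensity, bernoulliWeight, ht, mul_comm]
  have hint : Integrable fun t : ℝ => p * halfDensity true t + (1 - p) * halfDensity false t :=
    ((integrable_halfDensity true).const_mul p).add ((integrable_halfDensity false).const_mul _)
  rw [← ofReal_integral_eq_lintegral_ofReal]
  · simp only [heq]
    rw [integral_add ((integrable_halfDensity true).const_mul p)
      ((integrable_halfDensity false).const_mul _), integral_const_mul, integral_const_mul,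
      integral_halfDensity, integral_halfDensity]
    norm_num
  · simpa only [heq] using hint
  · exact Filter.Eventually.of_forall fun t =>
      mul_nonneg (Real.exp_pos _).le (bernoulliWeight_pos h0 h1 _).le

theorem measurable_signConfig {V : Type*} : Measurable (signConfig : (V → ℝ) → V → Bool) :=
  measurable_pi_lambda _ fun v => measurable_to_bool (by
    have : (fun x : V → ℝ => signConfig x v) ⁻¹' {true} = {x | 0 < x v} := by
      ext x; simp [signConfig]
    rw [this]
    exact measurableSet_lt measurable_const (measurable_pi_apply v))

section Signs

variable {V : Type*} [Fintype V]

theorem measurableSet_signConfig (E : Set (V → Bool)) :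
    MeasurableSet (signConfig ⁻¹' E : Set (V → ℝ)) :=
  measurable_signConfig (Set.toFinite E).measurableSet

/-- The product of the measures on `ℝ` with density `exp (-|t|)`. -/
noncomputable def laplaceMeasure (V : Type*) [Fintype V] : Measure (V → ℝ) :=
  productDensityMeasure fun v x => Real.exp (-|x v|)

theorem measurable_laplace_density :
    Measurable fun x : V → ℝ => ENNReal.ofReal (∏ v, Real.exp (-|x v|)) := by
  fun_prop

theorem laplaceMeasure_apply {F : Set (V → ℝ)} (hF : MeasurableSet F) :
    laplaceMeasure V F = ∫⁻ x in F, ENNReal.ofReal (∏ v, Real.exp (-|x v|)) :=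
  withDensity_apply _ hF

/-- Every orthant has mass 1, so the total mass is `2 ^ |V|` and a sign density is exactly the
probability function of the signs. -/
theorem laplaceMeasure_orthant (ε : V → Bool) :
    laplaceMeasure V (signConfig ⁻¹' {ε}) = 1 := by
  have hm := measurableSet_signConfig ({ε} : Set (V → Bool))
  have hnn : ∀ b t, 0 ≤ halfDensity b t := fun b t => by
    unfold halfDensity; split_ifs; exacts [(Real.exp_pos _).le, le_rfl]
  have heq : ∀ x : V → ℝ, (signConfig ⁻¹' {ε}).indicator
      (fun x => ENNReal.ofReal (∏ v, Real.exp (-|x v|))) x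
      = ENNReal.ofReal (∏ v, halfDensity (ε v) (x v)) := by
    intro x
    by_cases hx : signConfig x = ε
    · rw [Set.indicator_of_mem (by exact hx)]
      subst hx
      simp [halfDensity, signConfig]
    · rw [Set.indicator_of_notMem (by exact hx)]
      obtain ⟨v, hv⟩ := Function.ne_iff.1 hx
      rw [Finset.prod_eq_zero (Finset.mem_univ v), ENNReal.ofReal_zero]
      exact if_neg hv
  rw [laplaceMeasure_apply hm, ← lintegral_indicator hm]
  simp only [heq]
  rw [← ofReal_integral_eq_lintegral_ofReal]
  · rw [integral_fintype_prod_volume_eq_prod (fun v => halfDensity (ε v))]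
    simp [integral_halfDensity]
  · exact Integrable.fintype_prod (fun v => integrable_halfDensity (ε v))
  · exact Filter.Eventually.of_forall fun x => Finset.prod_nonneg fun v _ => hnn _ _

/-- Reflections of coordinates outside `C` do not change the mass of events determined by the
coordinates in `C`. -/
theorem laplaceMeasure_inter_orthant {C : Set V} {F : Set (V → ℝ)}
    (hF : MeasurableSet[MeasurableSpace.comap (fun (x : V → ℝ) (c : C) => x c) inferInstance] F)
    {ε ε' : V → Bool} (hε : ∀ c ∈ C, ε c = ε' c) :
    laplaceMeasure V (F ∩ signConfig ⁻¹' {ε}) = laplaceMeasure V (F ∩ signConfig ⁻¹' {ε'}) := by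
  -- `T` reflects the coordinates at which `ε` and `ε'` differ, none of which is in `C`.
  let T : (V → ℝ) → (V → ℝ) := fun x v => (if ε v = ε' v then id else Neg.neg) (x v)
  have hT : MeasurePreserving T volume volume :=
    volume_preserving_pi fun v => by
      split_ifs
      exacts [MeasurePreserving.id _, Measure.measurePreserving_neg _]
  have hC : Measurable fun (x : V → ℝ) (c : C) => x c :=
    measurable_pi_lambda _ fun c => measurable_pi_apply c.1
  have hFm : MeasurableSet F := hC.comap_le _ hF
  obtain ⟨F', -, rfl⟩ := hF
  have hFT : ∀ x, (fun (c : C) => T x c) = fun (c : C) => x c := fun x => by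
    funext c
    simp [T, hε c c.2]
  have hdens : ∀ x, ENNReal.ofReal (∏ v, Real.exp (-|T x v|))
      = ENNReal.ofReal (∏ v, Real.exp (-|x v|)) := fun x => by
    congr 1
    refine Finset.prod_congr rfl fun v _ => ?_
    simp only [T]
    split_ifs
    · rfl
    · rw [abs_neg]
  have hm := fun ε : V → Bool => hFm.inter (measurableSet_signConfig {ε})
  rw [laplaceMeasure_apply (hm ε), laplaceMeasure_apply (hm ε'),
    ← hT.setLIntegral_comp_preimage (hm ε') measurable_laplace_density]
  simp only [hdens]
  refine setLIntegral_congr ?_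
  -- The value 0 counts as negative, so a reflection flips the sign only off the coordinate
  -- hyperplanes.
  have hne : ∀ᵐ x : V → ℝ, ∀ v, x v ≠ 0 := ae_all_iff.2 fun v => Measure.ae_eval_ne _ v 0
  filter_upwards [hne] with x hx
  refine propext (and_congr ?_ ?_)
  · change (fun (c : C) => x c) ∈ F' ↔ (fun (c : C) => T x c) ∈ F'
    rw [hFT]
  · change signConfig x = ε ↔ signConfig (T x) = ε'
    rw [funext_iff, funext_iff]
    refine forall_congr' fun v => ?_
    simp only [signConfig, T]
    split_ifs with h
    · rw [h]; rfl
    · have h1 : decide (0 < -x v) = !decide (0 < x v) := by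
        rcases lt_or_gt_of_ne (hx v) with h0 | h0 <;> simp [h0, h0.le]
      rw [h1]
      cases decide (0 < x v) <;> cases hε : ε v <;> cases hε' : ε' v <;> simp_all

theorem sum_measure_inter_orthant (P : Measure (V → ℝ)) (F : Set (V → ℝ))
    (E : Finset (V → Bool)) :
    ∑ ε ∈ E, P (F ∩ signConfig ⁻¹' {ε}) = P (F ∩ signConfig ⁻¹' E) := by
  have h := sum_measure_preimage_singleton (μ := P.restrict F) (f := signConfig) E
    fun ε _ => measurableSet_signConfig {ε}
  rw [Measure.restrict_apply (measurableSet_signConfig _)] at h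
  rw [Set.inter_comm, ← h]
  refine Finset.sum_congr rfl fun ε _ => ?_
  rw [Measure.restrict_apply (measurableSet_signConfig _), Set.inter_comm]

/-- `P` has the density `g (signConfig x)` with respect to the Laplace measure. -/
def HasSignDensity (P : Measure (V → ℝ)) (g : (V → Bool) → ℝ) : Prop :=
  ∀ F, MeasurableSet F → ∀ ε,
    P (F ∩ signConfig ⁻¹' {ε}) = ENNReal.ofReal (g ε) * laplaceMeasure V (F ∩ signConfig ⁻¹' {ε})

namespace HasSignDensity

variable {P : Measure (V → ℝ)} {g : (V → Bool) → ℝ}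

theorem measure_preimage (hP : HasSignDensity P g) (E : Finset (V → Bool)) :
    P (signConfig ⁻¹' E) = ∑ ε ∈ E, ENNReal.ofReal (g ε) := by
  have h : ∀ ε, P (signConfig ⁻¹' {ε}) = ENNReal.ofReal (g ε) := fun ε => by
    simpa [laplaceMeasure_orthant] using hP _ MeasurableSet.univ ε
  simpa [h] using (sum_measure_inter_orthant P Set.univ E).symm

theorem real_preimage (hP : HasSignDensity P g) (hg : ∀ ε, 0 ≤ g ε) (E : Finset (V → Bool)) :
    P.real (signConfig ⁻¹' E) = ∑ ε ∈ E, g ε := by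
  rw [measureReal_def, hP.measure_preimage, ← ENNReal.ofReal_sum_of_nonneg fun ε _ => hg ε,
    ENNReal.toReal_ofReal (Finset.sum_nonneg fun ε _ => hg ε)]

/-- All orthants in `E` agree on `C`, so by reflection they give the same Laplace mass to `F`. The
event `F` about `X_C` and the signs therefore factorize. -/
theorem measure_inter (hP : HasSignDensity P g) {C : Set V} {F : Set (V → ℝ)}
    (hF : MeasurableSet[MeasurableSpace.comap (fun (x : V → ℝ) (c : C) => x c) inferInstance] F)
    {E : Finset (V → Bool)} (hE : ∀ ε ∈ E, ∀ c ∈ C, ε c = true) :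
    P (F ∩ signConfig ⁻¹' E)
      = laplaceMeasure V (F ∩ signConfig ⁻¹' {fun _ => true}) * P (signConfig ⁻¹' E) := by
  have hC : Measurable fun (x : V → ℝ) (c : C) => x c :=
    measurable_pi_lambda _ fun c => measurable_pi_apply c.1
  rw [← sum_measure_inter_orthant, hP.measure_preimage, Finset.mul_sum]
  refine Finset.sum_congr rfl fun ε hε => ?_
  rw [hP _ (hC.comap_le _ hF), laplaceMeasure_inter_orthant hF (hE ε hε), mul_comm]

/-- Given that `X_C` is positive, the signs are independent of `X_C`. -/
theorem condExp_preimage [IsFiniteMeasure P] (hP : HasSignDensity P g) {C : Set V}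
    {H E : Finset (V → Bool)} (hH : ∀ ε, ε ∈ H ↔ ∀ c ∈ C, ε c = true) (hEH : E ⊆ H)
    {E' : Finset (V → Bool)} (hE' : ∀ ε, ε ∈ E ↔ ε ∈ H ∧ ε ∈ E')
    (hpos : 0 < P.real (signConfig ⁻¹' H)) :
    ∀ᵐ x ∂P, x ∈ signConfig ⁻¹' (H : Set (V → Bool)) →
      (P⟦signConfig ⁻¹' (E' : Set (V → Bool)) |
        MeasurableSpace.comap (fun (x : V → ℝ) (c : C) => x c) inferInstance⟧) x
        = P.real (signConfig ⁻¹' E) / P.real (signConfig ⁻¹' H) := by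
  have hC : Measurable fun (x : V → ℝ) (c : C) => x c :=
    measurable_pi_lambda _ fun c => measurable_pi_apply c.1
  have hsetInt : ∀ (S F : Set (V → ℝ)) (r : ℝ), MeasurableSet S →
      ∫ x in F, S.indicator (fun _ => r) x ∂P = r * P.real (F ∩ S) := by
    intro S F r hS
    rw [setIntegral_indicator hS, setIntegral_const, smul_eq_mul, mul_comm]
  have hm := hC.comap_le
  set m := MeasurableSpace.comap (fun (x : V → ℝ) (c : C) => x c) inferInstance 
  have hHm : MeasurableSet[m] (signConfig ⁻¹' (H : Set (V → Bool))) := by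
    refine ⟨Set.univ.pi fun _ => Set.Ioi 0, MeasurableSet.univ_pi fun _ => measurableSet_Ioi, ?_⟩
    ext x
    simp [hH, signConfig]
  have hset : signConfig ⁻¹' (E : Set (V → Bool))
      = signConfig ⁻¹' (H : Set (V → Bool)) ∩ signConfig ⁻¹' (E' : Set (V → Bool)) := by
    ext x
    simp [hE']
  have hind : (signConfig ⁻¹' (H : Set (V → Bool))).indicator
      ((signConfig ⁻¹' (E' : Set (V → Bool))).indicator fun _ => (1 : ℝ))
      = (signConfig ⁻¹' (E : Set (V → Bool))).indicator fun _ => (1 : ℝ) := by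
    rw [Set.indicator_indicator, hset]
  have h1 := condExp_indicator (m := m) (μ := P) (f := (signConfig ⁻¹' (E' : Set (V → Bool))).indicator
    fun _ => (1 : ℝ)) ((integrable_const 1).indicator (measurableSet_signConfig _)) hHm
  rw [hind] at h1
  -- The constant ratio on `H`, extended by 0, has the right integral over each event in the
  -- σ-algebra of `X_C`, by `measure_inter`.
  have h2 := ae_eq_condExp_of_forall_setIntegral_eq (μ := P) hm
    (f := (signConfig ⁻¹' (E : Set (V → Bool))).indicator fun _ => (1 : ℝ))
    (g := (signConfig ⁻¹' (H : Set (V → Bool))).indicator fun _ =>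
      P.real (signConfig ⁻¹' E) / P.real (signConfig ⁻¹' H))
    ((integrable_const 1).indicator (measurableSet_signConfig _))
    (fun s _ _ => ((integrable_const _).indicator (measurableSet_signConfig _)).integrableOn)
    (fun F hF _ => by
      rw [hsetInt _ _ _ (measurableSet_signConfig _), hsetInt _ _ _ (measurableSet_signConfig _),
        measureReal_def (s := F ∩ _), measureReal_def (s := F ∩ _),
        hP.measure_inter hF fun ε hε => (hH ε).1 hε,
        hP.measure_inter hF fun ε hε => (hH ε).1 (hEH hε), ENNReal.toReal_mul, ENNReal.toReal_mul,
        ← measureReal_def (μ := P), ← measureReal_def (μ := P)]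
      field_simp)
    (StronglyMeasurable.aestronglyMeasurable (stronglyMeasurable_const.indicator hHm))
  filter_upwards [h1, h2] with x hx1 hx2 hx
  rw [← hx2, Set.indicator_of_mem hx, Set.indicator_of_mem hx] at hx1
  exact hx1.symm

/-- Conditional independence implies that the signs are uncorrelated, given that all signs in `C`
are positive. -/
theorem cov_eq_zero_of_condIndep [DecidableEq V] [IsFiniteMeasure P] (hP : HasSignDensity P g)
    (hg : ∀ ε, 0 < g ε) {A B C : Set V} (h : CondIndepCoords P A B C) {a b : V} (ha : a ∈ A)
    (hb : b ∈ B) :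
    (∑ ε, trueOn C ε * g ε * (coordInd a ε * coordInd b ε)) * (∑ ε, trueOn C ε * g ε * 1)
      = (∑ ε, trueOn C ε * g ε * coordInd a ε) * ∑ ε, trueOn C ε * g ε * coordInd b ε := by
  classical
  let H : Finset (V → Bool) := Finset.univ.filter fun ε => ∀ c ∈ C, ε c = true
  let E (v : V) : Finset (V → Bool) := Finset.univ.filter fun ε => ε v = true
  have hH : ∀ ε, ε ∈ H ↔ ∀ c ∈ C, ε c = true := fun ε => by simp [H]
  have hpos : 0 < P.real (signConfig ⁻¹' H) := by
    rw [hP.real_preimage fun ε => (hg ε).le]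
    exact Finset.sum_pos (fun ε _ => hg ε) ⟨fun _ => true, by simp [H]⟩
  have hmeas : ∀ D : Set V, Measurable fun (x : V → ℝ) (c : D) => x c := fun D =>
    measurable_pi_lambda _ fun c => measurable_pi_apply c.1
  have hpre : ∀ (D : Set V) (v : V) (hv : v ∈ D), (fun (x : V → ℝ) (c : D) => x c) ⁻¹'
      {y | 0 < y ⟨v, hv⟩} = signConfig ⁻¹' (E v : Set (V → Bool)) := fun D v hv => by
    ext x
    simp [E, signConfig]
  have key := (condIndepFun_iff_condExp_inter_preimage_eq_mul (hmeas A) (hmeas B)).1 h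
    {y | 0 < y ⟨a, ha⟩} {y | 0 < y ⟨b, hb⟩}
    (measurableSet_lt measurable_const (measurable_pi_apply _))
    (measurableSet_lt measurable_const (measurable_pi_apply _))
  rw [hpre, hpre, ← Set.preimage_inter, ← Finset.coe_inter] at key
  have hc := fun E' : Finset (V → Bool) => hP.condExp_preimage (E := H ∩ E') hH
    Finset.inter_subset_left (fun ε => Finset.mem_inter) hpos
  -- Where `X_C` is positive, the three conditional probabilities are almost surely constant. That
  -- event has positive mass, so the product formula can be read off at a single point of it.
  have hex : ∃ x, (x ∈ signConfig ⁻¹' (H : Set (V → Bool))) ∧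
      (P.real (signConfig ⁻¹' ↑(H ∩ (E a ∩ E b))) / P.real (signConfig ⁻¹' H)
        = P.real (signConfig ⁻¹' ↑(H ∩ E a)) / P.real (signConfig ⁻¹' H) *
          (P.real (signConfig ⁻¹' ↑(H ∩ E b)) / P.real (signConfig ⁻¹' H))) := by
    have hfreq : ∃ᵐ x ∂P, x ∈ signConfig ⁻¹' (H : Set (V → Bool)) := by
      rw [frequently_ae_mem_iff]
      intro h0
      rw [measureReal_def, h0] at hpos
      simp at hpos
    obtain ⟨x, hx, h1, h2, h3, h4⟩ := (hfreq.and_eventually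
      (key.and ((hc (E a ∩ E b)).and ((hc (E a)).and (hc (E b)))))).exists
    refine ⟨x, hx, ?_⟩
    rw [← h2 hx, ← h3 hx, ← h4 hx, h1]
  obtain ⟨-, -, hx⟩ := hex
  have hsum : ∀ (E' : Finset (V → Bool)) (f : (V → Bool) → ℝ), (∀ ε, f ε = if ε ∈ E' then 1 else 0) →
      ∑ ε, trueOn C ε * g ε * f ε = P.real (signConfig ⁻¹' ↑(H ∩ E')) := by
    intro E' f hf
    rw [hP.real_preimage fun ε => (hg ε).le, ← Finset.sum_filter_add_sum_filter_not Finset.univ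
      (fun ε => ε ∈ H ∩ E')]
    rw [Finset.sum_eq_zero (s := Finset.univ.filter fun ε => ε ∉ H ∩ E'), add_zero]
    · refine Finset.sum_congr (by ext; simp) fun ε hε => ?_
      rw [Finset.mem_inter, hH] at hε
      simp [trueOn, hf, hε.2, if_pos hε.1]
    · intro ε hε
      rw [Finset.mem_filter, Finset.mem_inter, hH] at hε
      by_cases h1 : ∀ c ∈ C, ε c = true
      · have h2 : ε ∉ E' := fun h2 => hε.2 ⟨h1, h2⟩
        simp [hf, h2]
      · simp [trueOn, h1]
  rw [hsum (E a ∩ E b) _ fun ε => by by_cases ε a = true <;> by_cases ε b = true <;>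
      simp_all [E, coordInd], hsum Finset.univ _ fun ε => by simp,
    hsum (E a) _ fun ε => by simp [E, coordInd], hsum (E b) _ fun ε => by simp [E, coordInd],
    Finset.inter_univ]
  field_simp at hx
  linarith

end HasSignDensity

end Signs

theorem hasSignDensity_productDensityMeasure {V : Type*} [Fintype V] {k : V → (V → Bool) → ℝ}
    (hk : ∀ v ε, 0 ≤ k v ε) :
    HasSignDensity (productDensityMeasure fun v x => Real.exp (-|x v|) * k v (signConfig x))
      fun ε => ∏ v, k v ε := by
  intro F hF ε
  have hm := hF.inter (measurableSet_signConfig ({ε} : Set (V → Bool)))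
  rw [productDensityMeasure, withDensity_apply _ hm, laplaceMeasure_apply hm,
    ← lintegral_const_mul _ measurable_laplace_density]
  refine setLIntegral_congr_fun hm fun x hx => ?_
  have hx : signConfig x = ε := hx.2
  simp only [hx]
  rw [Finset.prod_mul_distrib, mul_comm, ENNReal.ofReal_mul (Finset.prod_nonneg fun v _ => hk v ε)]

/-! ### The real-valued mixture with prescribed signs -/

namespace MixtureDAG

variable {V : Type*} {K : ℕ} (G : MixtureDAG V K)

/-- The conditional densities whose signs form the binary network with parameters `θ`. -/
noncomputable def signCond (j₀ : Fin K) (θ : Fin K → V → (V → Bool) → ℝ) (j : Fin K) (v : V)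
    (x : V → ℝ) : ℝ :=
  Real.exp (-|x v|) * (G.component j).kernel (G.tie j₀ θ j) v (signConfig x)

variable {j₀ : Fin K} {θ : Fin K → V → (V → Bool) → ℝ}

theorem kernel_tie_pos (hθ : ∀ j, θ j ∈ openParams V) (j : Fin K) (v : V) (ε : V → Bool) :
    0 < (G.component j).kernel (G.tie j₀ θ j) v ε :=
  bernoulliWeight_pos (tie_mem_openParams j₀ hθ j v _).1 (tie_mem_openParams j₀ hθ j v _).2 _

theorem hasSignDensity_signCond [Fintype V] (hθ : ∀ j, θ j ∈ openParams V) (j : Fin K) :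
    HasSignDensity (productDensityMeasure (G.signCond j₀ θ j))
      fun ε => ∏ v, (G.component j).kernel (G.tie j₀ θ j) v ε :=
  hasSignDensity_productDensityMeasure fun v ε => (G.kernel_tie_pos hθ j v ε).le

variable [DecidableEq V]

theorem signCond_lintegral (hθ : ∀ j, θ j ∈ openParams V) (j : Fin K) (v : V) (x : V → ℝ) :
    ∫⁻ t : ℝ, ENNReal.ofReal (G.signCond j₀ θ j v (Function.update x v t)) = 1 := by
  have hp : ∀ t, (G.component j).parentConfig v (signConfig (Function.update x v t))
      = (G.component j).parentConfig v (signConfig x) := fun t => by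
    refine Digraph.parentConfig_congr _ fun u hu => ?_
    rw [signConfig, Function.update_of_ne, signConfig]
    rintro rfl
    exact G.acyclic j _ (.single hu)
  simp only [signCond, Digraph.kernel, hp, Function.update_self]
  simp only [signConfig, Function.update_self]
  exact lintegral_exp_mul_bernoulliWeight (tie_mem_openParams j₀ hθ j v _).1
    (tie_mem_openParams j₀ hθ j v _).2

variable [Fintype V]

theorem isProbabilityMeasure_signCond (hθ : ∀ j, θ j ∈ openParams V) (j : Fin K) :
    IsProbabilityMeasure (productDensityMeasure (G.signCond j₀ θ j)) := by
  constructor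
  have h := (G.hasSignDensity_signCond (j₀ := j₀) hθ j).measure_preimage Finset.univ
  rw [Finset.coe_univ, Set.preimage_univ] at h
  rw [h, ← ENNReal.ofReal_sum_of_nonneg fun ε _ =>
    Finset.prod_nonneg fun v _ => (G.kernel_tie_pos hθ j v ε).le]
  have := Digraph.condSum_empty_one (G.acyclic j) (G.tie j₀ θ j)
  simp only [Digraph.condSum, trueOn, Set.mem_empty_iff_false, false_imp_iff, implies_true,
    if_true, one_mul, mul_one] at this
  rw [this, ENNReal.ofReal_one]

/-- The mixture whose signs form a mixture of binary networks. -/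
noncomputable def signModel (j₀ : Fin K) {θ : Fin K → V → (V → Bool) → ℝ}
    (hθ : ∀ j, θ j ∈ openParams V) {w : Fin K → ℝ≥0} (hw : ∀ j, 0 < w j) (hsum : ∑ j, w j = 1) :
    MixtureModel G.component where
  weight := w
  weight_pos := hw
  weight_sum := hsum
  cond := G.signCond j₀ θ
  cond_pos j v x := mul_pos (Real.exp_pos _) (G.kernel_tie_pos hθ j v _)
  cond_measurable j v := Measurable.mul (by fun_prop)
    ((Measurable.of_discrete (f := (G.component j).kernel (G.tie j₀ θ j) v)).comp
      measurable_signConfig)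
  cond_dependsOn j v x y h := by
    have hv : x v = y v := h v (Set.mem_insert _ _)
    rw [signCond, signCond, hv, Digraph.kernel_congr (G.component j) (x' := signConfig y)]
    · rw [signConfig, signConfig, hv]
    · intro u hu
      rw [signConfig, signConfig, h u (Set.mem_insert_of_mem _ hu)]
  cond_lintegral := G.signCond_lintegral hθ
  isProbabilityMeasure_component := G.isProbabilityMeasure_signCond hθ

theorem invariantNodes_signModel (hθ : ∀ j, θ j ∈ openParams V) {w : Fin K → ℝ≥0}
    (hw : ∀ j, 0 < w j) (hsum : ∑ j, w j = 1)
    (hinv : ∀ v ∉ G.inv, ∃ j k, θ j v (fun _ => false) ≠ θ k v fun _ => false) :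
    (G.signModel j₀ hθ hw hsum).invariantNodes = G.inv := by
  ext v
  constructor
  · intro h
    by_contra hv
    obtain ⟨j, k, hne⟩ := hinv v hv
    have hjk : G.signCond j₀ θ j v =ᵐ[volume] G.signCond j₀ θ k v := h j k
    -- The components may give `v` different parents, but in the orthant without positive
    -- coordinates every parent configuration is constantly `false`, so the parameters at this
    -- configuration can be compared.
    have hpos : volume (signConfig ⁻¹' {fun _ => false} : Set (V → ℝ)) ≠ 0 := fun h0 => by
      have : laplaceMeasure V (signConfig ⁻¹' {fun _ => false}) = 0 :=
        withDensity_absolutelyContinuous _ _ h0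
      rw [laplaceMeasure_orthant] at this
      exact one_ne_zero this
    obtain ⟨x, hx, hxe⟩ := ((frequently_ae_mem_iff.2 hpos).and_eventually hjk).exists
    have hx : signConfig x = fun _ => false := hx
    have hval : ∀ i, (G.component i).kernel (G.tie j₀ θ i) v (signConfig x)
        = 1 - θ i v fun _ => false := by
      intro i
      have hp : (G.component i).parentConfig v (fun _ => false) = fun _ => false := by
        funext u
        simp [Digraph.parentConfig]
      rw [Digraph.kernel, hx, hp]
      simp [bernoulliWeight, tie, hv]
    rw [signCond, signCond, hval, hval] at hxe
    have := mul_left_cancel₀ (Real.exp_pos _).ne' hxe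
    exact hne (by linarith)
  · intro hv j k
    refine Filter.Eventually.of_forall fun x => ?_
    have hadj : ∀ u, (G.component j).Adj u v ↔ (G.component k).Adj u v := fun u =>
      Set.ext_iff.1 (G.parents_eq v hv j k) u
    have hp : (G.component j).parentConfig v (signConfig x)
        = (G.component k).parentConfig v (signConfig x) := by
      funext u
      by_cases hu : (G.component j).Adj u v
      · rw [Digraph.parentConfig_of_adj _ hu, Digraph.parentConfig_of_adj _ ((hadj u).1 hu)]
      · rw [Digraph.parentConfig_of_not_adj _ hu,
          Digraph.parentConfig_of_not_adj _ (mt (hadj u).2 hu)]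
    change G.signCond j₀ θ j v x = G.signCond j₀ θ k v x
    rw [signCond, signCond, Digraph.kernel, Digraph.kernel, hp]
    simp [tie, hv]

theorem hasSignDensity_law_signModel (hθ : ∀ j, θ j ∈ openParams V) {w : Fin K → ℝ≥0}
    (hw : ∀ j, 0 < w j) (hsum : ∑ j, w j = 1) :
    HasSignDensity (G.signModel j₀ hθ hw hsum).law
      fun ε => ∑ j, w j * ∏ v, (G.component j).kernel (G.tie j₀ θ j) v ε := by
  intro F hF ε
  have hnn : ∀ j, 0 ≤ ∏ v, (G.component j).kernel (G.tie j₀ θ j) v ε := fun j =>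
    Finset.prod_nonneg fun v _ => (G.kernel_tie_pos hθ j v ε).le
  have hj : ∀ j, (G.signModel j₀ hθ hw hsum).component j (F ∩ signConfig ⁻¹' {ε}) = _ := fun j =>
    G.hasSignDensity_signCond hθ j F hF ε
  rw [MixtureModel.law, Measure.finsetSum_apply]
  beta_reduce
  rw [ENNReal.ofReal_sum_of_nonneg fun j _ => mul_nonneg (w j).coe_nonneg (hnn j), Finset.sum_mul]
  refine Finset.sum_congr rfl fun j _ => ?_
  rw [Measure.smul_apply, hj, ENNReal.ofReal_mul (w j).coe_nonneg, ENNReal.ofReal_coe_nnreal, mul_assoc]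
  rfl

theorem sum_mul_eq_mixSum (w : Fin K → ℝ) (C : Set V) (h : (V → Bool) → ℝ) :
    ∑ ε, trueOn C ε * (∑ j, w j * ∏ v, (G.component j).kernel (G.tie j₀ θ j) v ε) * h ε
      = G.mixSum j₀ θ w C h := by
  simp only [mixSum, compSum, Digraph.condSum, Finset.mul_sum, Finset.sum_mul]
  rw [Finset.sum_comm]
  exact Finset.sum_congr rfl fun j _ => Finset.sum_congr rfl fun ε _ => by ring

theorem mixSum_div (w : Fin K → ℝ) (r : ℝ) (C : Set V) (h : (V → Bool) → ℝ) :
    G.mixSum j₀ θ (fun j => w j / r) C h = G.mixSum j₀ θ w C h / r := by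
  rw [mixSum, mixSum, Finset.sum_div]
  exact Finset.sum_congr rfl fun j _ => by ring

end MixtureDAG

theorem mainTheorem3 {V : Type*} [Fintype V] [DecidableEq V] {K : ℕ} (hK : 1 ≤ K)
    (G : MixtureDAG V K) :
    ∃ M : MixtureModel G.component, M.invariantNodes = G.inv ∧ G.IsFaithful M.law := by
  let j₀ : Fin K := ⟨0, hK⟩
  obtain ⟨θ, w, hθ, hw, hinv, hfaith⟩ := G.exists_faithful_params j₀
  have hpos : 0 < ∑ j, w j := Finset.sum_pos (fun j _ => hw j) ⟨j₀, Finset.mem_univ _⟩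
  -- The generic weights are only positive. The covariance is homogeneous in them, so normalizing
  -- does not affect whether it vanishes.
  let p : Fin K → ℝ≥0 := fun j => ⟨w j / ∑ k, w k, (div_pos (hw j) hpos).le⟩
  have hp : ∀ j, 0 < p j := fun j => div_pos (hw j) hpos
  have hsum : ∑ j, p j = 1 := by
    apply NNReal.coe_injective
    rw [NNReal.coe_sum, NNReal.coe_one]
    change ∑ j, w j / ∑ k, w k = 1
    rw [← Finset.sum_div, div_self hpos.ne']
  refine ⟨G.signModel j₀ hθ hp hsum, G.invariantNodes_signModel hθ hp hsum hinv, ?_⟩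
  intro A B C _ hAC hBC hci
  by_contra hsep
  have hdisj : Disjoint (MixtureDAG.copies K A) (MixtureDAG.copies K C) := by
    rw [Set.disjoint_left]
    rintro _ ⟨v, hv, j, rfl⟩ h
    exact Set.disjoint_left.1 hAC hv (MixtureDAG.some_mem_copies.1 h)
  obtain ⟨_, ⟨a, ha, i, rfl⟩, _, ⟨b, hb, j, rfl⟩, d, hr⟩ :=
    ballReach_of_not_dSeparated G.graph_asymm hdisj hsep
  refine hfaith C a b (Set.disjoint_left.1 hAC ha) (Set.disjoint_left.1 hBC hb) i j d hr ?_
  have hg : ∀ ε, 0 < ∑ j, (p j : ℝ) * ∏ v, (G.component j).kernel (G.tie j₀ θ j) v ε := fun ε =>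
    Finset.sum_pos (fun j _ => mul_pos (hp j)
      (Finset.prod_pos fun v _ => G.kernel_tie_pos hθ j v ε)) ⟨j₀, Finset.mem_univ _⟩
  have hcov := (G.hasSignDensity_law_signModel hθ hp hsum).cov_eq_zero_of_condIndep hg hci ha hb
  have hmix : ∀ h, G.mixSum j₀ θ (fun j => (p j : ℝ)) C h = G.mixSum j₀ θ w C h / ∑ k, w k :=
    fun h => G.mixSum_div w _ C h
  rw [G.sum_mul_eq_mixSum, G.sum_mul_eq_mixSum, G.sum_mul_eq_mixSum, G.sum_mul_eq_mixSum,
    hmix, hmix, hmix, hmix] at hcov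
  field_simp at hcov
  rw [MixtureDAG.mixCov, hcov, sub_self]
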